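/- Fix a countably infinite set of names; they serve both as the variables of the call-by-value $\lambda$-calculus $\lambda_v$ and as the names of the $\pi$-calculus. Terms and processes are taken up to $\alpha$-conversion. **$\lambda_v$.** Terms are $t ::= x \mid t\,t \mid \lambda x.t$, values are $v ::= x \mid \lambda x.t$, and $\to_v$ is the least relation with $(\lambda x.t)v\to_v\{v/x\}t$ that is closed under $s\to_v s'\Rightarrow s\,t\to_v s'\,t$ and $t\to_v t'\Rightarrow s\,t\to_v s\,t'$. **$\pi$-calculus.** Processes are $P ::= 0 \mid P|P \mid {!P} \mid (\nu a)P \mid a(b).P \mid \overline{a}\langle b\rangle.P \mid \checkmark$. Structural equivalence $\equiv$ is the least congruence with $P|0\equiv P$, $P|Q\equiv Q|P$, $P|(Q|R)\equiv(P|Q)|R$, $!P\equiv P|{!P}$, $(\nu n)0\equiv 0$, $(\nu n)(\nu m)P\equiv(\nu m)(\nu n)P$, and $P|(\nu n)Q\equiv(\nu n)(P|Q)$ if $n\notin\mathrm{fn}(P)$. Reduction $\to$ is generated by $a(b).P\mid\overline{a}\langle c\rangle.Q\to\{c/b\}P\mid Q$ and closed under parallel composition, restriction and $\equiv$. Write $\Rightarrow$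 for the reflexive transitive closure of a reduction relation. Let $P\simeq Q$ mean that for every name substitution $\sigma$, $\sigma P$ and $\sigma Q$ are weakly (late) bisimilar with respect to the usual labelled transitions (internal action, input, free and bound output, and the observation of an unguarded $\checkmark$). **Milner's translation.** For every $\lambda$-term $t$ and name $c$, the process $[\![t]\!]_c$ is given, with all bound names chosen fresh, by $$[\![v]\!]_c=(\nu y)\,\overline{c}\langle y\rangle.[\![y:=v]\!]\ \ (v\text{ a value},\ y\text{ not free in } v),\qquad [\![s\,t]\!]_c=(\nu q)(\nu r)\big(\mathsf{ap}(c,q,r)\mid[\![s]\!]_q\mid[\![t]\!]_r\big),$$ $$[\![y:=\lambda x.t]\!]={!y(w).w(x).w(c).[\![t]\!]_c},\qquad[\![y:=x]\!]={!y(w).\overline{x}\langle w\rangle.0},$$ $$\mathsf{ap}(p,q,r)=q(y).(\nu v)\,\overline{y}\langle v\rangle.r(z).\overline{v}\langle z\rangle.\overline{v}\langle p\rangle.0 .$$ **Theorem.** The translation $[\![\cdot]\!]_c$, with the renaming policy $\varphi$ that maps every name to itself (a $1$-tuple), is a parallel encoding of $\lambda_v$ into the $\pi$-calculus. That is: 1.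 *Compositionality.* For every $k$-ary operator $\mathsf{op}$ of the $\lambda$-calculus (each variable $x$ with $k=0$, each abstraction $\lambda x.\_$ with $k=1$, application with $k=2$), every set $N$ of names and every name $c$ there are a $k$-ary $\pi$-calculus context $C$ (each of its $k$ holes occurs exactly once; its binders may capture names in the holes) and names $d_1,\dots,d_k$ such that $[\![\mathsf{op}(S_1,\dots,S_k)]\!]_c=C([\![S_1]\!]_{d_1};\dots;[\![S_k]\!]_{d_k})$ for all terms $S_1,\dots,S_k$ whose free variables together form $N$. 2. *Name invariance.* For all terms $S$, names $c$ and substitutions $\sigma,\sigma'$ of names for names with $\varphi(\sigma(a))=\sigma'(\varphi(a))$ for every name $a$: $[\![\sigma S]\!]_{\sigma'(c)}=\sigma'[\![S]\!]_c$ if $\sigma$ is injective, and $[\![\sigma S]\!]_{\sigma'(c)}\simeq\sigma'[\![S]\!]_c$ otherwise. 3. *Operational correspondence.* For every name $c$: if $S\Rightarrow_v S'$, then there is $T$ with $[\![S]\!]_c\Rightarrow T\simeq[\![S']\!]_c$; and if $[\![S]\!]_c\Rightarrow T$, then there are $S'$ and $T'$ with $S\Rightarrow_v S'$, $T\Rightarrow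 T'$ and $T'\simeq[\![S']\!]_c$. 4. *Divergence reflection.* For every name $c$ and term $S$: if $[\![S]\!]_c$ has an infinite sequence of reductions, then so has $S$. 5. *Parallelisation.* There is a process $\mathcal A(\cdot,\cdot,\cdot)$ with three name parameters such that, for all terms $M,N$, every name $c$ and all distinct names $n_1,n_2$ that are different from $c$ and not free in $[\![M\,N]\!]_c$, $[\![M\,N]\!]_c=(\nu n_1)(\nu n_2)\big(\mathcal A(c,n_1,n_2)\mid[\![M]\!]_{n_1}\mid[\![N]\!]_{n_2}\big)$. -/

import Mathlib

/-!
# Call-by-value lambda-calculus, pi-calculus, and parallel encodings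

Names (and the variables of the lambda-calculus, which are names) are natural numbers.  Terms and
processes are represented by de Bruijn indices, so that `=` is equality up to alpha-conversion: an
index that points outside all binders denotes a free name, and below a binder the index `0` is the
bound name while the name `n` of the outside is written `n + 1`.  Binding a *given* name is the
derived operation `LTerm.abs` / `PiProc.nu` / `PiProc.input`.
-/

namespace LambdaPi

/-- The renaming that turns the name `a` into the bound name of a new binder. -/
def bindName (a : ℕ) (n : ℕ) : ℕ := if n = a then 0 else n + 1

/-- The renaming that replaces the bound name of the removed binder by the name `c`. -/
def instName (c : ℕ) : ℕ → ℕ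
  | 0 => c
  | n + 1 => n

/-- The extension of a renaming below one binder. -/
def upName (σ : ℕ → ℕ) : ℕ → ℕ
  | 0 => 0
  | n + 1 => σ n + 1

/-- The exchange of the two innermost bound names. -/
def swapName : ℕ → ℕ
  | 0 => 1
  | 1 => 0
  | n + 2 => n + 2

/-- Reflexive transitive closure `⇒` of a reduction relation. -/
abbrev Many {α : Type} (r : α → α → Prop) : α → α → Prop := Relation.ReflTransGen r

/-- `x` has an infinite sequence of reductions. -/
def Diverges {α : Type} (r : α → α → Prop) (x : α) : Prop :=
  ∃ f : ℕ → α, f 0 = x ∧ ∀ n, r (f n) (f (n + 1))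

/-! ## The call-by-value lambda-calculus -/

/-- Lambda-terms `t ::= x | t t | λx.t`. -/
inductive LTerm : Type
  | var (x : ℕ)
  | app (s t : LTerm)
  | lam (t : LTerm)

namespace LTerm

/-- Application of a name substitution (variables to variables), avoiding capture. -/
def rename : (ℕ → ℕ) → LTerm → LTerm
  | σ, var x => var (σ x)
  | σ, app s t => app (rename σ s) (rename σ t)
  | σ, lam t => lam (rename (upName σ) t)

/-- The abstraction `λx.t` of the name `x` in `t`. -/
def abs (x : ℕ) (t : LTerm) : LTerm := lam (t.rename (bindName x))

/-- Extension of a substitution of terms for variables below one binder. -/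
def upSubst (θ : ℕ → LTerm) : ℕ → LTerm
  | 0 => var 0
  | n + 1 => (θ n).rename Nat.succ

/-- Application of a substitution of terms for variables, avoiding capture. -/
def subst : (ℕ → LTerm) → LTerm → LTerm
  | θ, var x => θ x
  | θ, app s t => app (subst θ s) (subst θ t)
  | θ, lam t => lam (subst (upSubst θ) t)

/-- The substitution of `u` for the variable bound by the removed binder. -/
def instSubst (u : LTerm) : ℕ → LTerm
  | 0 => u
  | n + 1 => var n

/-- Free variables. -/
def fv : LTerm → Set ℕ
  | var x => {x}
  | app s t => fv s ∪ fv t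
  | lam t => {n | n + 1 ∈ fv t}

/-- Values `v ::= x | λx.t`. -/
inductive IsValue : LTerm → Prop
  | var (x : ℕ) : IsValue (var x)
  | lam (t : LTerm) : IsValue (lam t)

/-- The reduction relation of the call-by-value lambda-calculus. -/
inductive Red : LTerm → LTerm → Prop
  | beta {t v : LTerm} : IsValue v → Red (app (lam t) v) (subst (instSubst v) t)
  | appL {s s' t : LTerm} : Red s s' → Red (app s t) (app s' t)
  | appR {s t t' : LTerm} : Red t t' → Red (app s t) (app s t')

end LTerm

/-- The operators of the lambda-calculus: each variable (arity 0), each abstraction `λx` (arity 1),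
and application (arity 2). -/
inductive LOp : Type
  | var (x : ℕ)
  | abs (x : ℕ)
  | app

/-- The number of arguments of an operator. -/
def LOp.arity : LOp → ℕ
  | var _ => 0
  | abs _ => 1
  | app => 2

/-- The term built by an operator from its arguments. -/
def LOp.apply : (op : LOp) → (Fin op.arity → LTerm) → LTerm
  | var x, _ => .var x
  | abs x, S => .abs x (S (0 : Fin 1))
  | app, S => .app (S (0 : Fin 2)) (S (1 : Fin 2))

/-! ## The pi-calculus -/

/-- Processes `P ::= 0 | P|P | !P | (νa)P | a(b).P | a⟨b⟩.P | ✓`.  In `res P` and in `inp a P`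
one name is bound in `P`. -/
inductive PiProc : Type
  | nil
  | par (P Q : PiProc)
  | rep (P : PiProc)
  | res (P : PiProc)
  | inp (a : ℕ) (P : PiProc)
  | out (a b : ℕ) (P : PiProc)
  | ok

namespace PiProc

/-- Application of a name substitution, avoiding capture. -/
def rename : (ℕ → ℕ) → PiProc → PiProc
  | _, nil => nil
  | σ, par P Q => par (rename σ P) (rename σ Q)
  | σ, rep P => rep (rename σ P)
  | σ, res P => res (rename (upName σ) P)
  | σ, inp a P => inp (σ a) (rename (upName σ) P)
  | σ, out a b P => out (σ a) (σ b) (rename σ P)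
  | _, ok => ok

/-- A process seen from below one more binder, which does not bind any of its names. -/
def shift (P : PiProc) : PiProc := P.rename Nat.succ

/-- The body `P` of a removed binder, with the name `c` for the bound name. -/
def inst (c : ℕ) (P : PiProc) : PiProc := P.rename (instName c)

/-- Free names. -/
def fn : PiProc → Set ℕ
  | nil => ∅
  | par P Q => fn P ∪ fn Q
  | rep P => fn P
  | res P => {n | n + 1 ∈ fn P}
  | inp a P => {a} ∪ {n | n + 1 ∈ fn P}
  | out a b P => {a, b} ∪ fn P
  | ok => ∅

/-- The restriction `(νa)P` of the name `a`. -/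
def nu (a : ℕ) (P : PiProc) : PiProc := res (P.rename (bindName a))

/-- The input `a(b).P` that binds the name `b`. -/
def input (a b : ℕ) (P : PiProc) : PiProc := inp a (P.rename (bindName b))

/-- Structural equivalence: the congruence generated by the usual laws. -/
inductive Struct : PiProc → PiProc → Prop
  | refl (P : PiProc) : Struct P P
  | symm {P Q : PiProc} : Struct P Q → Struct Q P
  | trans {P Q R : PiProc} : Struct P Q → Struct Q R → Struct P R
  | congPar {P P' Q Q' : PiProc} : Struct P P' → Struct Q Q' → Struct (par P Q) (par P' Q')
  | congRep {P P' : PiProc} : Struct P P' → Struct (rep P) (rep P')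
  | congRes {P P' : PiProc} : Struct P P' → Struct (res P) (res P')
  | congInp {a : ℕ} {P P' : PiProc} : Struct P P' → Struct (inp a P) (inp a P')
  | congOut {a b : ℕ} {P P' : PiProc} : Struct P P' → Struct (out a b P) (out a b P')
  | parNil (P : PiProc) : Struct (par P nil) P
  | parComm (P Q : PiProc) : Struct (par P Q) (par Q P)
  | parAssoc (P Q R : PiProc) : Struct (par P (par Q R)) (par (par P Q) R)
  | repUnfold (P : PiProc) : Struct (rep P) (par P (rep P))
  | resNil : Struct (res nil) nil
  | resSwap (P : PiProc) : Struct (res (res P)) (res (res (P.rename swapName)))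
  | extrude (P Q : PiProc) : Struct (par P (res Q)) (res (par P.shift Q))

/-- The reduction relation. -/
inductive Red : PiProc → PiProc → Prop
  | comm (a c : ℕ) (P Q : PiProc) : Red (par (inp a P) (out a c Q)) (par (P.inst c) Q)
  | par {P P' : PiProc} (Q : PiProc) : Red P P' → Red (par P Q) (par P' Q)
  | res {P P' : PiProc} : Red P P' → Red (res P) (res P')
  | struct {P Q Q' P' : PiProc} : Struct P Q → Red Q Q' → Struct Q' P' → Red P P'

end PiProc

/-! ### Weak bisimilarity -/

/-- Actions: internal action, free output, bound output, input, and success.  The process reached by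
a bound output or an input lives below one binder, for the extruded resp. the received name. -/
inductive Act : Type
  | tau
  | out (a b : ℕ)
  | bout (a : ℕ)
  | inp (a : ℕ)
  | ok

namespace Act

/-- The action seen from below one more binder. -/
def shift : Act → Act
  | tau => tau
  | out a b => out (a + 1) (b + 1)
  | bout a => bout (a + 1)
  | inp a => inp (a + 1)
  | ok => ok

/-- A bystander of the action, placed below the binder of the action (if there is one). -/
def bystander : Act → PiProc → PiProc
  | bout _, Q => Q.shift
  | inp _, Q => Q.shift
  | _, Q => Q

/-- Moves a surrounding restriction below the binder of the action (if there is one). -/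
def underRes : Act → PiProc → PiProc
  | bout _, P => P.rename swapName
  | inp _, P => P.rename swapName
  | _, P => P

end Act

/-- The (late) labelled transition system of the pi-calculus. -/
inductive Trans : PiProc → Act → PiProc → Prop
  | inp (a : ℕ) (P : PiProc) : Trans (.inp a P) (.inp a) P
  | out (a b : ℕ) (P : PiProc) : Trans (.out a b P) (.out a b) P
  | ok : Trans .ok .ok .ok
  | parL {P P' : PiProc} {α : Act} (Q : PiProc) :
      Trans P α P' → Trans (.par P Q) α (.par P' (α.bystander Q))
  | parR {Q Q' : PiProc} {α : Act} (P : PiProc) :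
      Trans Q α Q' → Trans (.par P Q) α (.par (α.bystander P) Q')
  | commL {P P' Q Q' : PiProc} {a b : ℕ} :
      Trans P (.inp a) P' → Trans Q (.out a b) Q' → Trans (.par P Q) .tau (.par (P'.inst b) Q')
  | commR {P P' Q Q' : PiProc} {a b : ℕ} :
      Trans P (.out a b) P' → Trans Q (.inp a) Q' → Trans (.par P Q) .tau (.par P' (Q'.inst b))
  | closeL {P P' Q Q' : PiProc} {a : ℕ} :
      Trans P (.inp a) P' → Trans Q (.bout a) Q' → Trans (.par P Q) .tau (.res (.par P' Q'))
  | closeR {P P' Q Q' : PiProc} {a : ℕ} :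
      Trans P (.bout a) P' → Trans Q (.inp a) Q' → Trans (.par P Q) .tau (.res (.par P' Q'))
  | res {P P' : PiProc} {α : Act} :
      Trans P α.shift P' → Trans (.res P) α (.res (α.underRes P'))
  | opening {P P' : PiProc} {a : ℕ} :
      Trans P (.out (a + 1) 0) P' → Trans (.res P) (.bout a) P'
  | rep {P P' : PiProc} {α : Act} : Trans (.par P (.rep P)) α P' → Trans (.rep P) α P'

/-- Finitely many internal transitions. -/
def TauMany : PiProc → PiProc → Prop := Relation.ReflTransGen fun P P' => Trans P .tau P'

/-- `R` is a weak (late) simulation. -/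
structure IsWeakSim (R : PiProc → PiProc → Prop) : Prop where
  tau : ∀ {P Q P'}, R P Q → Trans P .tau P' → ∃ Q', TauMany Q Q' ∧ R P' Q'
  out : ∀ {P Q P' a b}, R P Q → Trans P (.out a b) P' →
    ∃ Q₁ Q₂ Q', TauMany Q Q₁ ∧ Trans Q₁ (.out a b) Q₂ ∧ TauMany Q₂ Q' ∧ R P' Q'
  bout : ∀ {P Q P' a}, R P Q → Trans P (.bout a) P' →
    ∃ Q₁ Q₂ Q', TauMany Q Q₁ ∧ Trans Q₁ (.bout a) Q₂ ∧ TauMany Q₂ Q' ∧ R P' Q'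
  inp : ∀ {P Q P' a}, R P Q → Trans P (.inp a) P' →
    ∃ Q₁ Q₂, TauMany Q Q₁ ∧ Trans Q₁ (.inp a) Q₂ ∧
      ∀ b, ∃ Q', TauMany (Q₂.inst b) Q' ∧ R (P'.inst b) Q'
  ok : ∀ {P Q P'}, R P Q → Trans P .ok P' →
    ∃ Q₁ Q₂ Q', TauMany Q Q₁ ∧ Trans Q₁ .ok Q₂ ∧ TauMany Q₂ Q' ∧ R P' Q'

/-- `P` and `Q` are related by a weak (late) bisimulation. -/
def WeakBisimilar (P Q : PiProc) : Prop :=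
  ∃ R : PiProc → PiProc → Prop, IsWeakSim R ∧ IsWeakSim (fun P Q => R Q P) ∧ R P Q

/-- The behavioural equivalence of the pi-calculus: weak bisimilarity under all name
substitutions. -/
def BehEquiv (P Q : PiProc) : Prop := ∀ σ : ℕ → ℕ, WeakBisimilar (P.rename σ) (Q.rename σ)

/-! ### Contexts -/

/-- Processes with holes `0, …, k-1`; the binders carry names, and capture names in the holes. -/
inductive PiCtx (k : ℕ) : Type
  | hole (i : Fin k)
  | nil
  | par (C D : PiCtx k)
  | rep (C : PiCtx k)
  | nu (a : ℕ) (C : PiCtx k)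
  | input (a b : ℕ) (C : PiCtx k)
  | output (a b : ℕ) (C : PiCtx k)
  | ok

namespace PiCtx

/-- The process obtained by putting `T i` into hole `i`. -/
def fill {k : ℕ} (T : Fin k → PiProc) : PiCtx k → PiProc
  | hole i => T i
  | nil => .nil
  | par C D => .par (fill T C) (fill T D)
  | rep C => .rep (fill T C)
  | nu a C => .nu a (fill T C)
  | input a b C => .input a b (fill T C)
  | output a b C => .out a b (fill T C)
  | ok => .ok

/-- How often hole `i` occurs. -/
def count {k : ℕ} (i : Fin k) : PiCtx k → ℕ
  | hole j => if j = i then 1 else 0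
  | nil => 0
  | par C D => count i C + count i D
  | rep C => count i C
  | nu _ C => count i C
  | input _ _ C => count i C
  | output _ _ C => count i C
  | ok => 0

/-- Every hole appears exactly once. -/
def IsKAry {k : ℕ} (C : PiCtx k) : Prop := ∀ i, C.count i = 1

end PiCtx

/-! ## Parallel encodings -/

/-- The renaming that instantiates three parameters, the indices `0, 1, 2`, and leaves the other
names (written `n + 3`) as they are. -/
def instThree (c n₁ n₂ : ℕ) : ℕ → ℕ
  | 0 => c
  | 1 => n₁
  | 2 => n₂
  | n + 3 => n

/-- `(⟦·⟧_c, φ)`, with a translation `tr c S = ⟦S⟧_c` parametrised by a name `c` and a renaming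
policy `φ` that maps each name to `k > 0` names, is a parallel encoding of the call-by-value
lambda-calculus into the pi-calculus. -/
structure IsParallelEncoding {k : ℕ} (tr : ℕ → LTerm → PiProc) (φ : ℕ → Fin k → ℕ) : Prop where
  arity_pos : 0 < k
  /-- Compositionality.  The holes are filled by translations of the arguments at names `d i` that
  the context may bind. -/
  compositionality : ∀ (op : LOp) (N : Set ℕ) (c : ℕ),
    ∃ (C : PiCtx op.arity) (d : Fin op.arity → ℕ), C.IsKAry ∧
      ∀ S : Fin op.arity → LTerm, (⋃ i, (S i).fv) = N →
        tr c (op.apply S) = C.fill fun i => tr (d i) (S i)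
  /-- Name invariance.  The parameter is a name of the target, so it is renamed as well. -/
  name_invariance : ∀ (S : LTerm) (c : ℕ) (σ σ' : ℕ → ℕ),
    (∀ a i, φ (σ a) i = σ' (φ a i)) →
      (Function.Injective σ → tr (σ' c) (S.rename σ) = (tr c S).rename σ') ∧
      (¬ Function.Injective σ → BehEquiv (tr (σ' c) (S.rename σ)) ((tr c S).rename σ'))
  /-- Operational correspondence, completeness. -/
  complete : ∀ (c : ℕ) (S S' : LTerm), Many LTerm.Red S S' →
    ∃ T, Many PiProc.Red (tr c S) T ∧ BehEquiv T (tr c S')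
  /-- Operational correspondence, soundness. -/
  sound : ∀ (c : ℕ) (S : LTerm) (T : PiProc), Many PiProc.Red (tr c S) T →
    ∃ S', Many LTerm.Red S S' ∧ ∃ T', Many PiProc.Red T T' ∧ BehEquiv T' (tr c S')
  /-- Divergence reflection. -/
  divergence_reflection : ∀ (c : ℕ) (S : LTerm),
    Diverges PiProc.Red (tr c S) → Diverges LTerm.Red S
  /-- Parallelisation: `⟦M N⟧_c = (νn₁)(νn₂)(A(c,n₁,n₂) | ⟦M⟧_n₁ | ⟦N⟧_n₂)`, where `n₁` and `n₂` are
  any two fresh names. -/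
  parallelisation : ∃ A : PiProc, ∀ (c : ℕ) (M N : LTerm) (n₁ n₂ : ℕ), n₁ ≠ n₂ →
    n₁ ∉ insert c (tr c (.app M N)).fn → n₂ ∉ insert c (tr c (.app M N)).fn →
      tr c (.app M N) = .nu n₁ (.nu n₂
        (.par (.par (A.rename (instThree c n₁ n₂)) (tr n₁ M)) (tr n₂ N)))

/-! ## Milner's translation -/

/-- `ap(p,q,r) = q(y).(νv) y⟨v⟩.r(z).v⟨z⟩.v⟨p⟩`. -/
def ap (p q r : ℕ) : PiProc :=
  -- below the binders: `y = 0`; then `v = 0, y = 1`; then `z = 0, v = 1`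
  .inp q (.res (.out 1 0 (.inp (r + 2) (.out 1 0 (.out 1 (p + 3) .nil)))))

/-- `⟦y := x⟧ = !y(w).x⟨w⟩`. -/
def assignVar (y x : ℕ) : PiProc := .rep (.inp y (.out (x + 1) 0 .nil))

/-- `⟦y := λx.t⟧ = !y(w).w(x).w(c).B`, where `B`, the translation of the body, lives below the binders
of `w = 2`, `x = 1`, `c = 0`. -/
def assignLam (y : ℕ) (B : PiProc) : PiProc := .rep (.inp y (.inp 0 (.inp 1 B)))

/-- `(νy) c⟨y⟩.B`, where `B` lives below the binder of `y = 0`. -/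
def ret (c : ℕ) (B : PiProc) : PiProc := .res (.out (c + 1) 0 B)

/-- Where the variables of the body of an abstraction are found below the four binders
`y = 3, w = 2, x = 1, c = 0`, if the variables of the abstraction are found at `ρ`. -/
def bodyNames (ρ : ℕ → ℕ) : ℕ → ℕ
  | 0 => 1
  | n + 1 => ρ n + 4

/-- The translation of a term whose variable `x` is the name `ρ x`. -/
def milnerAux : (ℕ → ℕ) → LTerm → ℕ → PiProc
  | ρ, .var x, c => ret c (assignVar 0 (ρ x + 1))
  | ρ, .lam t, c => ret c (assignLam 0 (milnerAux (bodyNames ρ) t 0))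
  | ρ, .app s t, c =>
      .res (.res (.par (.par (ap (c + 2) 1 0) (milnerAux (fun x => ρ x + 2) s 1))
        (milnerAux (fun x => ρ x + 2) t 0)))

/-- Milner's translation `⟦t⟧_c` of the call-by-value lambda-calculus. -/
def milner (c : ℕ) (t : LTerm) : PiProc := milnerAux id t c

end LambdaPi

namespace LambdaPi

/-! Every internal step of a translated term is behaviourally inert, including the steps that carry
out a β-reduction. The channels of an application are private and linear, with one sender and one
receiver, so communication on them has no competitor. A value becomes a private replicated server;
once its name stands for a variable it occurs only in calls, and since the server is stateless it
does not matter when a call is performed. Hence `⟦S⟧_c` is equivalent to each of its reducts, and to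
`⟦S'⟧_c` whenever `S ⇒ S'`. Both halves of operational correspondence are then witnessed by empty
reduction sequences.

Inertness is expressed by expansions: the left process mimics the right one except for further
internal steps, and a grade bounds how many of these can happen in a row without a move on the
right. Expansions are closed under evaluation contexts (`IsExpansion.evalClosure`), imply
equivalence (`Expands.behEquiv`) and carry termination from right to left (`Expands.terminates`).
They have three sources: structural equivalence, which is a strong bisimulation
(`Struct.simulates`); processes whose only move is one internal step (`Expands.of_deterministic`);
and the replacement of all calls of a private server by its body (`Inlined.expands`). The last one
yields substitution: a variable `x` is translated to `!y(w).x⟨w⟩`, and inlining the server of `v` at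
this call gives exactly the server `⟦y := v⟧`, so no step below the replication is needed
(`Provides.inlined`).

Reducts of translations are not translations, so partially evaluated applications are recorded by
configurations. Every internal transition of a configuration is a configuration step up to expansion
(`Conf.exists_step`), every such step is inert (`Conf.Step.expandsMany`), and it either contracts a
β-redex or keeps the term and lowers a size (`Conf.Step.toTerm`). The last dichotomy gives
divergence reflection. Name invariance holds as an equality, and compositionality and
parallelisation only require fresh names for the binders. -/

/-! ### Renaming of names below binders -/

@[simp] theorem upName_zero (σ : ℕ → ℕ) : upName σ 0 = 0 := rfl
@[simp] theorem upName_succ (σ : ℕ → ℕ) (n : ℕ) : upName σ (n + 1) = σ n + 1 := rfl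
@[simp] theorem upName_one (σ : ℕ → ℕ) : upName σ 1 = σ 0 + 1 := rfl
@[simp] theorem instName_zero (c : ℕ) : instName c 0 = c := rfl
@[simp] theorem instName_succ (c n : ℕ) : instName c (n + 1) = n := rfl
@[simp] theorem instName_one (c : ℕ) : instName c 1 = 0 := rfl
@[simp] theorem swapName_zero : swapName 0 = 1 := rfl
@[simp] theorem swapName_one : swapName 1 = 0 := rfl
@[simp] theorem swapName_succ_succ (n : ℕ) : swapName (n + 2) = n + 2 := rfl

theorem upName_id : upName id = id := by
  funext n; cases n <;> rfl

theorem upName_comp (σ τ : ℕ → ℕ) : upName σ ∘ upName τ = upName (σ ∘ τ) := by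
  funext n; cases n <;> rfl

theorem upName_injective {σ : ℕ → ℕ} (h : Function.Injective σ) :
    Function.Injective (upName σ) := by
  rintro (_ | m) (_ | n) e
  · rfl
  · simp at e
  · simp at e
  · simp only [upName_succ, Nat.add_right_cancel_iff] at e
    rw [h e]

namespace PiProc

theorem rename_rename (σ τ : ℕ → ℕ) (P : PiProc) :
    (P.rename τ).rename σ = P.rename (σ ∘ τ) := by
  induction P generalizing σ τ <;> simp_all [rename, upName_comp]

theorem rename_id (P : PiProc) : P.rename id = P := by
  induction P <;> simp_all [rename, upName_id]

theorem rename_eq_self {σ : ℕ → ℕ} (h : ∀ n, σ n = n) (P : PiProc) : P.rename σ = P := by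
  rw [show σ = id from funext h, rename_id]

theorem mem_fn_rename {σ : ℕ → ℕ} {P : PiProc} {n : ℕ} :
    n ∈ (P.rename σ).fn ↔ ∃ m ∈ P.fn, σ m = n := by
  induction P generalizing σ n with
  | nil => simp [rename, fn]
  | ok => simp [rename, fn]
  | par P Q ihP ihQ => simp only [rename, fn, Set.mem_union, ihP, ihQ]; grind
  | rep P ih => simpa [rename, fn] using ih
  | res P ih =>
    simp only [rename, fn, Set.mem_ofPred_eq, ih]
    constructor
    · rintro ⟨_ | m, hm, e⟩
      · simp at e
      · exact ⟨m, hm, by simpa using e⟩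
    · rintro ⟨m, hm, rfl⟩
      exact ⟨m + 1, hm, rfl⟩
  | inp a P ih =>
    simp only [rename, fn, Set.mem_ofPred_eq, ih, Set.mem_union, Set.mem_singleton_iff]
    constructor
    · rintro (rfl | ⟨_ | m, hm, e⟩)
      · exact ⟨a, Or.inl rfl, rfl⟩
      · simp at e
      · exact ⟨m, Or.inr hm, by simpa using e⟩
    · rintro ⟨m, rfl | hm, rfl⟩
      · exact Or.inl rfl
      · exact Or.inr ⟨m + 1, hm, rfl⟩
  | out a b P ih =>
    simp only [rename, fn, ih, Set.mem_union, Set.mem_insert_iff, Set.mem_singleton_iff]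
    grind

end PiProc

/-! ### Transitions under renaming -/

namespace Act

/-- Application of a name substitution to an action. -/
def rename (σ : ℕ → ℕ) : Act → Act
  | tau => tau
  | out a b => out (σ a) (σ b)
  | bout a => bout (σ a)
  | inp a => inp (σ a)
  | ok => ok

/-- A renaming, extended below the binder of the action (if there is one). -/
def up : Act → (ℕ → ℕ) → ℕ → ℕ
  | bout _, σ => upName σ
  | inp _, σ => upName σ
  | _, σ => σ

theorem rename_shift (σ : ℕ → ℕ) (α : Act) : α.shift.rename (upName σ) = (α.rename σ).shift := by
  cases α <;> rfl

theorem bystander_rename (σ : ℕ → ℕ) (α : Act) (Q : PiProc) :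
    (α.bystander Q).rename (α.up σ) = (α.rename σ).bystander (Q.rename σ) := by
  cases α <;> simp only [bystander, up, rename, PiProc.shift, PiProc.rename_rename] <;> rfl

theorem underRes_rename (σ : ℕ → ℕ) (α : Act) (P : PiProc) :
    (α.underRes P).rename (upName (α.up σ)) =
      (α.rename σ).underRes (P.rename (α.shift.up (upName σ))) := by
  cases α <;> simp only [underRes, up, rename, shift, PiProc.rename_rename] <;>
  · congr 1; funext n; rcases n with _ | _ | n <;> rfl

/-- An extended renaming sends only the bound name `0` to `0`, so an action that avoids `0` after
renaming avoided it before. This pulls the rule for restriction back along a renaming. -/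
theorem exists_of_shift_eq_rename {σ : ℕ → ℕ} {α β : Act} (h : α.shift = β.rename (upName σ)) :
    ∃ γ : Act, β = γ.shift ∧ α = γ.rename σ := by
  rcases β with _ | ⟨_ | a, _ | b⟩ | ⟨_ | a⟩ | ⟨_ | a⟩ | _ <;> cases α <;>
    simp [shift, rename] at h
  · exact ⟨.tau, rfl, rfl⟩
  · exact ⟨.out a b, rfl, by rw [h.1, h.2]; rfl⟩
  · exact ⟨.bout a, rfl, by rw [h]; rfl⟩
  · exact ⟨.inp a, rfl, by rw [h]; rfl⟩
  · exact ⟨.ok, rfl, rfl⟩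

theorem bystander_par (α : Act) (P Q : PiProc) :
    α.bystander (.par P Q) = .par (α.bystander P) (α.bystander Q) := by
  cases α <;> rfl

end Act

namespace PiProc

theorem inst_rename (σ : ℕ → ℕ) (b : ℕ) (P : PiProc) :
    (P.inst b).rename σ = (P.rename (upName σ)).inst (σ b) := by
  simp only [inst, rename_rename]
  congr 1; funext n; cases n <;> rfl

theorem inst_shift (b : ℕ) (P : PiProc) : P.shift.inst b = P := by
  simp only [inst, shift, rename_rename]
  exact rename_eq_self (fun _ => rfl) P

theorem shift_rename (σ : ℕ → ℕ) (P : PiProc) :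
    P.shift.rename (upName σ) = (P.rename σ).shift := by
  simp only [shift, rename_rename]; rfl

theorem swap_swap (P : PiProc) : (P.rename swapName).rename swapName = P := by
  rw [rename_rename]
  exact rename_eq_self (by rintro (_ | _ | n) <;> rfl) P

end PiProc

/-- No injectivity is needed in this direction: identifying names can enable communications but
cannot disable any. -/
theorem Trans.rename (σ : ℕ → ℕ) {P P' : PiProc} {α : Act} (h : Trans P α P') :
    Trans (P.rename σ) (α.rename σ) (P'.rename (α.up σ)) := by
  induction h generalizing σ with
  | inp a P => exact .inp _ _
  | out a b P => exact .out _ _ _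
  | ok => exact .ok
  | @parL P P' α Q _ ih =>
    have := Trans.parL (Q.rename σ) (ih σ)
    rwa [← Act.bystander_rename] at this
  | @parR Q Q' α P _ ih =>
    have := Trans.parR (P.rename σ) (ih σ)
    rwa [← Act.bystander_rename] at this
  | commL _ _ ih₁ ih₂ =>
    have := Trans.commL (ih₁ σ) (ih₂ σ)
    rw [Act.up, ← PiProc.inst_rename] at this
    exact this
  | commR _ _ ih₁ ih₂ =>
    have := Trans.commR (ih₁ σ) (ih₂ σ)
    rw [show Act.up (.inp _) σ = upName σ from rfl, ← PiProc.inst_rename] at this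
    exact this
  | closeL _ _ ih₁ ih₂ => exact Trans.closeL (ih₁ σ) (ih₂ σ)
  | closeR _ _ ih₁ ih₂ => exact Trans.closeR (ih₁ σ) (ih₂ σ)
  | @res P P' α _ ih =>
    have := ih (upName σ)
    rw [Act.rename_shift] at this
    have := Trans.res this
    rwa [← Act.underRes_rename] at this
  | opening _ ih => exact Trans.opening (ih (upName σ))
  | rep _ ih => exact Trans.rep (ih σ)

/-- Injective renamings reflect transitions. -/
theorem Trans.of_rename {σ : ℕ → ℕ} (hσ : Function.Injective σ) {P X : PiProc} {α : Act}
    (h : Trans (P.rename σ) α X) :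
    ∃ β P', α = β.rename σ ∧ X = P'.rename (β.up σ) ∧ Trans P β P' := by
  generalize e : P.rename σ = R at h
  induction h generalizing σ P with
  | inp a Q =>
    cases P <;> simp only [PiProc.rename, reduceCtorEq, PiProc.inp.injEq] at e
    obtain ⟨rfl, rfl⟩ := e
    exact ⟨_, _, rfl, rfl, .inp _ _⟩
  | out a b Q =>
    cases P <;> simp only [PiProc.rename, reduceCtorEq, PiProc.out.injEq] at e
    obtain ⟨rfl, rfl, rfl⟩ := e
    exact ⟨_, _, rfl, rfl, .out _ _ _⟩
  | ok =>
    cases P <;> simp only [PiProc.rename, reduceCtorEq] at e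
    exact ⟨.ok, .ok, rfl, rfl, .ok⟩
  | parL Q _ ih =>
    cases P <;> simp only [PiProc.rename, reduceCtorEq, PiProc.par.injEq] at e
    obtain ⟨e₁, rfl⟩ := e
    obtain ⟨β, P', rfl, rfl, t⟩ := ih hσ e₁
    exact ⟨β, _, rfl, by rw [PiProc.rename, Act.bystander_rename], .parL _ t⟩
  | parR Q _ ih =>
    cases P <;> simp only [PiProc.rename, reduceCtorEq, PiProc.par.injEq] at e
    obtain ⟨rfl, e₁⟩ := e
    obtain ⟨β, P', rfl, rfl, t⟩ := ih hσ e₁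
    exact ⟨β, _, rfl, by rw [PiProc.rename, Act.bystander_rename], .parR _ t⟩
  | commL _ _ ih₁ ih₂ =>
    cases P <;> simp only [PiProc.rename, reduceCtorEq, PiProc.par.injEq] at e
    obtain ⟨β₁, P₁, e₁, rfl, t₁⟩ := ih₁ hσ e.1
    obtain ⟨β₂, P₂, e₂, rfl, t₂⟩ := ih₂ hσ e.2
    cases β₁ <;> simp only [Act.rename, reduceCtorEq, Act.inp.injEq] at e₁
    cases β₂ <;> simp only [Act.rename, reduceCtorEq, Act.out.injEq] at e₂
    obtain ⟨e₂, rfl⟩ := e₂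
    -- Injectivity is essential here: the two partners share a channel after the renaming, hence
    -- already before it.
    obtain rfl := hσ (e₁.symm.trans e₂)
    refine ⟨.tau, _, rfl, ?_, .commL t₁ t₂⟩
    simp only [Act.up, PiProc.rename, PiProc.inst_rename]
  | commR _ _ ih₁ ih₂ =>
    cases P <;> simp only [PiProc.rename, reduceCtorEq, PiProc.par.injEq] at e
    obtain ⟨β₁, P₁, e₁, rfl, t₁⟩ := ih₁ hσ e.1
    obtain ⟨β₂, P₂, e₂, rfl, t₂⟩ := ih₂ hσ e.2
    cases β₁ <;> simp only [Act.rename, reduceCtorEq, Act.out.injEq] at e₁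
    cases β₂ <;> simp only [Act.rename, reduceCtorEq, Act.inp.injEq] at e₂
    obtain ⟨e₁, rfl⟩ := e₁
    obtain rfl := hσ (e₁.symm.trans e₂)
    refine ⟨.tau, _, rfl, ?_, .commR t₁ t₂⟩
    simp only [Act.up, PiProc.rename, PiProc.inst_rename]
  | closeL _ _ ih₁ ih₂ =>
    cases P <;> simp only [PiProc.rename, reduceCtorEq, PiProc.par.injEq] at e
    obtain ⟨β₁, P₁, e₁, rfl, t₁⟩ := ih₁ hσ e.1
    obtain ⟨β₂, P₂, e₂, rfl, t₂⟩ := ih₂ hσ e.2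
    cases β₁ <;> simp only [Act.rename, reduceCtorEq, Act.inp.injEq] at e₁
    cases β₂ <;> simp only [Act.rename, reduceCtorEq, Act.bout.injEq] at e₂
    obtain rfl := hσ (e₁.symm.trans e₂)
    exact ⟨.tau, _, rfl, rfl, .closeL t₁ t₂⟩
  | closeR _ _ ih₁ ih₂ =>
    cases P <;> simp only [PiProc.rename, reduceCtorEq, PiProc.par.injEq] at e
    obtain ⟨β₁, P₁, e₁, rfl, t₁⟩ := ih₁ hσ e.1
    obtain ⟨β₂, P₂, e₂, rfl, t₂⟩ := ih₂ hσ e.2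
    cases β₁ <;> simp only [Act.rename, reduceCtorEq, Act.bout.injEq] at e₁
    cases β₂ <;> simp only [Act.rename, reduceCtorEq, Act.inp.injEq] at e₂
    obtain rfl := hσ (e₁.symm.trans e₂)
    exact ⟨.tau, _, rfl, rfl, .closeR t₁ t₂⟩
  | @res Q Q' α _ ih =>
    cases P <;> simp only [PiProc.rename, reduceCtorEq, PiProc.res.injEq] at e
    obtain ⟨β, P', e', rfl, t⟩ := ih (upName_injective hσ) e
    obtain ⟨γ, rfl, rfl⟩ := Act.exists_of_shift_eq_rename e'
    exact ⟨γ, _, rfl, by rw [PiProc.rename, Act.underRes_rename], .res t⟩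
  | opening _ ih =>
    cases P <;> simp only [PiProc.rename, reduceCtorEq, PiProc.res.injEq] at e
    obtain ⟨β, P', e', rfl, t⟩ := ih (upName_injective hσ) e
    rcases β with _ | ⟨_ | a, _ | b⟩ | _ | _ | _ <;>
      simp [Act.rename] at e'
    subst e'
    exact ⟨.bout a, _, rfl, rfl, .opening t⟩
  | rep _ ih =>
    cases P <;> simp only [PiProc.rename, reduceCtorEq, PiProc.rep.injEq] at e
    subst e
    obtain ⟨β, P', rfl, rfl, t⟩ := ih (P := .par _ (.rep _)) hσ rfl
    exact ⟨β, _, rfl, rfl, .rep t⟩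

/-! ### Structural equivalence is a strong bisimulation -/

namespace PiProc

theorem Struct.rename (σ : ℕ → ℕ) {P Q : PiProc} (h : Struct P Q) :
    Struct (P.rename σ) (Q.rename σ) := by
  induction h generalizing σ with
  | refl P => exact .refl _
  | symm _ ih => exact (ih σ).symm
  | trans _ _ ih₁ ih₂ => exact (ih₁ σ).trans (ih₂ σ)
  | congPar _ _ ih₁ ih₂ => exact .congPar (ih₁ σ) (ih₂ σ)
  | congRep _ ih => exact .congRep (ih σ)
  | congRes _ ih => exact .congRes (ih _)
  | congInp _ ih => exact .congInp (ih _)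
  | congOut _ ih => exact .congOut (ih _)
  | parNil P => exact .parNil _
  | parComm P Q => exact .parComm _ _
  | parAssoc P Q R => exact .parAssoc _ _ _
  | repUnfold P => exact .repUnfold _
  | resNil => exact .resNil
  | resSwap P =>
    have := Struct.resSwap (P.rename (upName (upName σ)))
    rw [rename_rename] at this
    simp only [PiProc.rename, rename_rename]
    rwa [show upName (upName σ) ∘ swapName = swapName ∘ upName (upName σ) by
      funext n; rcases n with _ | _ | n <;> rfl]
  | extrude P Q =>
    have := Struct.extrude (P.rename σ) (Q.rename (upName σ))
    rwa [← shift_rename] at this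

theorem Struct.bystander (α : Act) {P Q : PiProc} (h : Struct P Q) :
    Struct (α.bystander P) (α.bystander Q) := by
  cases α <;> first | exact h | exact h.rename _

theorem Struct.underRes (α : Act) {P Q : PiProc} (h : Struct P Q) :
    Struct (α.underRes P) (α.underRes Q) := by
  cases α <;> first | exact h | exact h.rename _

theorem Struct.parL {P P' : PiProc} (Q : PiProc) (h : Struct P P') : Struct (par P Q) (par P' Q) :=
  .congPar h (.refl Q)

theorem Struct.parR (P : PiProc) {Q Q' : PiProc} (h : Struct Q Q') : Struct (par P Q) (par P Q') :=
  .congPar (.refl P) h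

theorem Struct.nilPar (P : PiProc) : Struct (par nil P) P :=
  (Struct.parComm _ _).trans (.parNil P)

/-- `(P | Q) | R ≡ (P | R) | Q`. -/
theorem Struct.parRightComm (P Q R : PiProc) : Struct (par (par P Q) R) (par (par P R) Q) :=
  (Struct.parAssoc P Q R).symm.trans (((Struct.parComm Q R).parR P).trans (.parAssoc P R Q))

theorem Struct.parLeftComm (P Q R : PiProc) : Struct (par P (par Q R)) (par Q (par P R)) :=
  (Struct.parAssoc P Q R).trans (((Struct.parComm P Q).parL R).trans (Struct.parAssoc Q P R).symm)

theorem Struct.extrudeL (P Q : PiProc) : Struct (par (res P) Q) (res (par P Q.shift)) :=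
  (Struct.parComm _ _).trans ((Struct.extrude Q P).trans (.congRes (.parComm _ _)))

/-- A restriction of an unused name can be dropped. -/
theorem Struct.resShift (P : PiProc) : Struct (res P.shift) P := by
  have h₁ : Struct (res P.shift) (res (par P.shift nil)) := .congRes (Struct.parNil _).symm
  exact h₁.trans ((Struct.extrude P nil).symm.trans ((Struct.resNil.parR P).trans (.parNil P)))

end PiProc

theorem Act.bystander_inp (a : ℕ) (Q : PiProc) : (Act.inp a).bystander Q = Q.shift := rfl

/-- Transitions of a shifted process are shifted transitions. -/
theorem Trans.of_shift {P X : PiProc} {α : Act} (h : Trans P.shift α X) :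
    ∃ β P', α = β.shift ∧ X = P'.rename (β.up Nat.succ) ∧ Trans P β P' := by
  obtain ⟨β, P', rfl, rfl, t⟩ := Trans.of_rename Nat.succ_injective h
  exact ⟨β, P', by cases β <;> rfl, rfl, t⟩

theorem Trans.shift {P P' : PiProc} {α : Act} (h : Trans P α P') :
    Trans P.shift α.shift (P'.rename (α.up Nat.succ)) := by
  have := h.rename Nat.succ
  rwa [show α.rename Nat.succ = α.shift by cases α <;> rfl] at this

theorem Act.shift_injective : Function.Injective Act.shift := by
  intro α β h
  cases α <;> cases β <;> simp_all [Act.shift]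

theorem Trans.of_shift' {P X : PiProc} {α : Act} (h : Trans P.shift α.shift X) :
    ∃ P', X = P'.rename (α.up Nat.succ) ∧ Trans P α P' := by
  obtain ⟨β, P', e, rfl, t⟩ := h.of_shift
  obtain rfl := Act.shift_injective e
  exact ⟨P', rfl, t⟩

namespace PiProc

theorem inst_par (b : ℕ) (P Q : PiProc) : (par P Q).inst b = par (P.inst b) (Q.inst b) := rfl

/-- Every transition of `P` is matched by a transition of `Q` to a structurally equivalent
process. -/
def Simulates (P Q : PiProc) : Prop :=
  ∀ α P', Trans P α P' → ∃ Q', Trans Q α Q' ∧ Struct P' Q'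

theorem Simulates.trans {P Q R : PiProc} (h₁ : Simulates P Q) (h₂ : Simulates Q R) :
    Simulates P R := by
  intro α P' t
  obtain ⟨Q', t', s⟩ := h₁ α P' t
  obtain ⟨R', t'', s'⟩ := h₂ α Q' t'
  exact ⟨R', t'', s.trans s'⟩

/-- The structural equivalences of the components are needed besides the simulations, because a
component that stays idle in a transition must still be related to its partner afterwards. -/
theorem Simulates.par {P P' Q Q' : PiProc} (hP : Simulates P P') (hQ : Simulates Q Q')
    (sP : Struct P P') (sQ : Struct Q Q') : Simulates (par P Q) (par P' Q') := by
  intro α X t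
  cases t with
  | parL _ t =>
    obtain ⟨Y, t', s⟩ := hP _ _ t
    exact ⟨_, .parL _ t', .congPar s (sQ.bystander α)⟩
  | parR _ t =>
    obtain ⟨Y, t', s⟩ := hQ _ _ t
    exact ⟨_, .parR _ t', .congPar (sP.bystander α) s⟩
  | commL t₁ t₂ =>
    obtain ⟨Y₁, t₁', s₁⟩ := hP _ _ t₁
    obtain ⟨Y₂, t₂', s₂⟩ := hQ _ _ t₂
    exact ⟨_, .commL t₁' t₂', .congPar (s₁.rename _) s₂⟩
  | commR t₁ t₂ =>
    obtain ⟨Y₁, t₁', s₁⟩ := hP _ _ t₁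
    obtain ⟨Y₂, t₂', s₂⟩ := hQ _ _ t₂
    exact ⟨_, .commR t₁' t₂', .congPar s₁ (s₂.rename _)⟩
  | closeL t₁ t₂ =>
    obtain ⟨Y₁, t₁', s₁⟩ := hP _ _ t₁
    obtain ⟨Y₂, t₂', s₂⟩ := hQ _ _ t₂
    exact ⟨_, .closeL t₁' t₂', .congRes (.congPar s₁ s₂)⟩
  | closeR t₁ t₂ =>
    obtain ⟨Y₁, t₁', s₁⟩ := hP _ _ t₁
    obtain ⟨Y₂, t₂', s₂⟩ := hQ _ _ t₂
    exact ⟨_, .closeR t₁' t₂', .congRes (.congPar s₁ s₂)⟩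

theorem Simulates.refl (P : PiProc) : Simulates P P := fun _ P' t => ⟨P', t, .refl P'⟩

theorem Simulates.res {P P' : PiProc} (h : Simulates P P') : Simulates (res P) (res P') := by
  intro α X t
  cases t with
  | res t =>
    obtain ⟨Y, t', s⟩ := h _ _ t
    exact ⟨_, .res t', .congRes (s.underRes α)⟩
  | opening t =>
    obtain ⟨Y, t', s⟩ := h _ _ t
    exact ⟨_, .opening t', s⟩

theorem Simulates.parNil (P : PiProc) : Simulates (.par P nil) P := by
  intro α X t
  cases t with
  | parL _ t =>
    refine ⟨_, t, ?_⟩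
    have : α.bystander nil = nil := by cases α <;> rfl
    rw [this]
    exact .parNil _
  | parR _ t => cases t
  | commL _ t => cases t
  | commR _ t => cases t
  | closeL _ t => cases t
  | closeR _ t => cases t

theorem Simulates.parNil_symm (P : PiProc) : Simulates P (.par P nil) := by
  intro α X t
  refine ⟨_, .parL _ t, ?_⟩
  have : α.bystander nil = nil := by cases α <;> rfl
  rw [this]
  exact (Struct.parNil _).symm

theorem Simulates.parComm (P Q : PiProc) : Simulates (.par P Q) (.par Q P) := by
  intro α X t
  cases t with
  | parL _ t => exact ⟨_, .parR _ t, .parComm _ _⟩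
  | parR _ t => exact ⟨_, .parL _ t, .parComm _ _⟩
  | commL t₁ t₂ => exact ⟨_, .commR t₂ t₁, .parComm _ _⟩
  | commR t₁ t₂ => exact ⟨_, .commL t₂ t₁, .parComm _ _⟩
  | closeL t₁ t₂ => exact ⟨_, .closeR t₂ t₁, .congRes (.parComm _ _)⟩
  | closeR t₁ t₂ => exact ⟨_, .closeL t₂ t₁, .congRes (.parComm _ _)⟩

theorem Simulates.parAssoc (P Q R : PiProc) :
    Simulates (.par P (.par Q R)) (.par (.par P Q) R) := by
  intro α X t
  cases t with
  | parL _ t =>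
    refine ⟨_, .parL _ (.parL _ t), ?_⟩
    rw [Act.bystander_par]
    exact .parAssoc _ _ _
  | parR _ t =>
    cases t with
    | parL _ t => exact ⟨_, .parL _ (.parR _ t), .parAssoc _ _ _⟩
    | parR _ t =>
      refine ⟨_, .parR _ t, ?_⟩
      rw [Act.bystander_par]
      exact .parAssoc _ _ _
    | commL t₁ t₂ => exact ⟨_, .commL (.parR _ t₁) t₂, by
        rw [inst_par, Act.bystander_inp, inst_shift]
        exact .parAssoc _ _ _⟩
    | commR t₁ t₂ => exact ⟨_, .commR (.parR _ t₁) t₂, .parAssoc _ _ _⟩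
    | closeL t₁ t₂ =>
      exact ⟨_, .closeL (.parR _ t₁) t₂, (Struct.extrude _ _).trans (.congRes (.parAssoc _ _ _))⟩
    | closeR t₁ t₂ =>
      exact ⟨_, .closeR (.parR _ t₁) t₂, (Struct.extrude _ _).trans (.congRes (.parAssoc _ _ _))⟩
  | commL t₁ t₂ =>
    cases t₂ with
    | parL _ t₂ => exact ⟨_, .parL _ (.commL t₁ t₂), .parAssoc _ _ _⟩
    | parR _ t₂ => exact ⟨_, .commL (.parL _ t₁) t₂, by
        rw [inst_par, Act.bystander_inp, inst_shift]
        exact .parAssoc _ _ _⟩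
  | commR t₁ t₂ =>
    cases t₂ with
    | parL _ t₂ => exact ⟨_, .parL _ (.commR t₁ t₂), by
        rw [inst_par, Act.bystander_inp, inst_shift]
        exact .parAssoc _ _ _⟩
    | parR _ t₂ => exact ⟨_, .commR (.parL _ t₁) t₂, by
        rw [inst_par, Act.bystander_inp, inst_shift]
        exact .parAssoc _ _ _⟩
  | closeL t₁ t₂ =>
    cases t₂ with
    | parL _ t₂ => exact ⟨_, .parL _ (.closeL t₁ t₂),
        (Struct.congRes (.parAssoc _ _ _)).trans (Struct.extrudeL _ _).symm⟩
    | parR _ t₂ => exact ⟨_, .closeL (.parL _ t₁) t₂, .congRes (.parAssoc _ _ _)⟩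
  | closeR t₁ t₂ =>
    cases t₂ with
    | parL _ t₂ => exact ⟨_, .parL _ (.closeR t₁ t₂),
        (Struct.congRes (.parAssoc _ _ _)).trans (Struct.extrudeL _ _).symm⟩
    | parR _ t₂ => exact ⟨_, .closeR (.parL _ t₁) t₂, .congRes (.parAssoc _ _ _)⟩

theorem rename_upSucc_swap (P : PiProc) :
    (P.rename (upName Nat.succ)).rename swapName = P.shift := by
  rw [rename_rename, shift]
  congr 1; funext n; rcases n with _ | n <;> rfl

theorem shift_swap (P : PiProc) : P.shift.rename swapName = P.rename (upName Nat.succ) := by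
  rw [← rename_upSucc_swap, swap_swap]

theorem upSucc_inst (b : ℕ) (P : PiProc) :
    (P.rename (upName Nat.succ)).inst (b + 1) = (P.inst b).shift :=
  (inst_rename Nat.succ b P).symm

theorem upSucc_inst_zero (P : PiProc) : (P.rename (upName Nat.succ)).inst 0 = P := by
  rw [inst, rename_rename]
  exact rename_eq_self (by rintro (_ | n) <;> rfl) P

theorem swap_inst (b : ℕ) (P : PiProc) :
    (res (P.rename swapName)).inst b = res (P.inst (b + 1)) := by
  simp only [inst, PiProc.rename, rename_rename]
  congr 2; funext n; rcases n with _ | _ | n <;> rfl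

theorem Simulates.resSwap (P : PiProc) :
    Simulates (.res (.res P)) (.res (.res (P.rename swapName))) := by
  -- A bound output or an input puts a third binder below the two restrictions. Moving it outwards
  -- before or after the exchange of the restrictions gives results that agree by the braid relation
  -- for adjacent transpositions.
  have braid : ∀ Z : PiProc, Struct (.res (.rename swapName (.res (Z.rename swapName))))
      (.res (.rename swapName (.res ((Z.rename (upName swapName)).rename swapName)))) := by
    intro Z
    simp only [PiProc.rename, rename_rename]
    refine (Struct.resSwap _).trans ?_
    rw [rename_rename]
    convert Struct.refl _ using 4
    funext n; rcases n with _ | _ | _ | n <;> rfl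
  intro α X t
  cases t with
  | res t =>
    cases α with
    | bout a =>
      cases t with
      | res t =>
        exact ⟨_, .res (α := .bout a) (.res (α := .bout (a + 1)) (t.rename swapName)), braid _⟩
      | opening t =>
        exact ⟨_, .opening (.res (α := .out (a + 1) 0) (t.rename swapName)), .refl _⟩
    | tau =>
      cases t with
      | res t => exact ⟨_, .res (α := .tau) (.res (α := .tau) (t.rename swapName)), .resSwap _⟩
    | out a b =>
      cases t with
      | res t =>
        exact ⟨_, .res (α := .out a b) (.res (α := .out (a + 1) (b + 1)) (t.rename swapName)),
          .resSwap _⟩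
    | inp a =>
      cases t with
      | res t =>
        exact ⟨_, .res (α := .inp a) (.res (α := .inp (a + 1)) (t.rename swapName)), braid _⟩
    | ok =>
      cases t with
      | res t => exact ⟨_, .res (α := .ok) (.res (α := .ok) (t.rename swapName)), .resSwap _⟩
  | opening t =>
    cases t with
    | res t =>
      refine ⟨_, .res (α := .bout _) (.opening (t.rename swapName)), ?_⟩
      simp only [Act.underRes, Act.up, Act.shift, swap_swap]
      exact .refl _

/-- The scope of the restriction decides which rule applies: a communication by `closeL` that opens
the restriction on the left becomes an ordinary `commL` below the restriction on the right. If the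
transmitted name is private to another binder, the two restrictions end up in the opposite order and
are exchanged. -/
theorem Simulates.extrude (P Q : PiProc) :
    Simulates (.par P (.res Q)) (.res (.par P.shift Q)) := by
  intro α X t
  cases t with
  | parL _ t =>
    refine ⟨_, .res (.parL _ t.shift), ?_⟩
    cases α <;> first
    | exact Struct.extrude _ _
    | simp only [Act.underRes, Act.up, Act.shift, Act.bystander, PiProc.rename,
        rename_upSucc_swap, shift_swap]
      exact Struct.extrude _ _
  | parR _ t =>
    cases t with
    | res t =>
      refine ⟨_, .res (.parR _ t), ?_⟩
      cases α <;> first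
      | exact Struct.extrude _ _
      | simp only [Act.underRes, Act.shift, Act.bystander, PiProc.rename, shift_swap,
          shift_rename]
        exact Struct.extrude _ _
    | opening t => exact ⟨_, .opening (.parR _ t), .refl _⟩
  | commL t₁ t₂ =>
    cases t₂ with
    | res t₂ =>
      refine ⟨_, .res (α := .tau) (.commL t₁.shift t₂), ?_⟩
      simp only [Act.underRes, Act.up, upSucc_inst]
      exact .extrude _ _
  | commR t₁ t₂ =>
    cases t₂ with
    | res t₂ =>
      refine ⟨_, .res (α := .tau) (.commR t₁.shift t₂), ?_⟩
      simp only [Act.underRes, Act.up, swap_inst]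
      exact .extrude _ _
  | closeL t₁ t₂ =>
    cases t₂ with
    | res t₂ =>
      refine ⟨_, .res (α := .tau) (.closeL t₁.shift t₂), ?_⟩
      refine (Struct.congRes (.extrude _ _)).trans (.trans ?_ (Struct.resSwap _).symm)
      simp only [Act.underRes, Act.up, PiProc.rename, rename_upSucc_swap]
      exact .refl _
    | opening t₂ =>
      refine ⟨_, .res (α := .tau) (.commL t₁.shift t₂), ?_⟩
      simp only [Act.underRes, Act.up, upSucc_inst_zero]
      exact .refl _
  | closeR t₁ t₂ =>
    cases t₂ with
    | res t₂ =>
      refine ⟨_, .res (α := .tau) (.closeR t₁.shift t₂), ?_⟩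
      refine (Struct.congRes (.extrude _ _)).trans (.trans ?_ (Struct.resSwap _).symm)
      simp only [Act.underRes, Act.up, PiProc.rename, rename_upSucc_swap]
      exact .refl _

/-- The converse rests on `Trans.of_shift`: a shifted process moves only as the original one does,
so it neither uses nor emits the restricted name. -/
theorem Simulates.extrude_symm (P Q : PiProc) :
    Simulates (.res (.par P.shift Q)) (.par P (.res Q)) := by
  intro α X t
  cases t with
  | res t =>
    generalize eβ : α.shift = β at t
    cases t with
    | parL _ t =>
      subst eβ
      obtain ⟨P', rfl, t'⟩ := t.of_shift'
      refine ⟨_, .parL _ t', ?_⟩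
      cases α <;> first
      | exact (Struct.extrude _ _).symm
      | simp only [Act.underRes, Act.up, Act.shift, Act.bystander, PiProc.rename,
          rename_upSucc_swap, shift_swap]
        exact (Struct.extrude _ _).symm
    | parR _ t =>
      subst eβ
      refine ⟨_, .parR _ (.res t), ?_⟩
      cases α <;> first
      | exact (Struct.extrude _ _).symm
      | simp only [Act.underRes, Act.shift, Act.bystander, PiProc.rename, shift_swap,
          shift_rename]
        exact (Struct.extrude _ _).symm
    | @commL _ _ _ _ _ b t₁ t₂ =>
      cases α <;> cases eβ
      obtain ⟨γ, P', e, rfl, t₁'⟩ := t₁.of_shift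
      cases γ <;> cases e
      -- The object `0` is the restricted name, so its transmission opens the scope; any other
      -- object was free outside.
      cases b with
      | zero =>
        refine ⟨_, .closeL t₁' (.opening t₂), ?_⟩
        simp only [Act.underRes, Act.up, upSucc_inst_zero]
        exact .refl _
      | succ b =>
        refine ⟨_, .commL t₁' (.res (α := .out _ b) t₂), ?_⟩
        simp only [Act.underRes, Act.up, upSucc_inst]
        exact (Struct.extrude _ _).symm
    | commR t₁ t₂ =>
      cases α <;> cases eβ
      obtain ⟨γ, P', e, rfl, t₁'⟩ := t₁.of_shift
      cases γ <;> cases e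
      refine ⟨_, .commR t₁' (.res (α := .inp _) t₂), ?_⟩
      simp only [Act.underRes, Act.up, swap_inst]
      exact (Struct.extrude _ _).symm
    | closeL t₁ t₂ =>
      cases α <;> cases eβ
      obtain ⟨γ, P', e, rfl, t₁'⟩ := t₁.of_shift
      cases γ <;> cases e
      refine ⟨_, .closeL t₁' (.res (α := .bout _) t₂), ?_⟩
      refine .trans (.trans (.resSwap _) ?_) (Struct.congRes (.extrude _ _)).symm
      simp only [Act.underRes, Act.up, PiProc.rename, rename_upSucc_swap]
      exact .refl _
    | closeR t₁ t₂ =>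
      cases α <;> cases eβ
      obtain ⟨γ, P', e, rfl, t₁'⟩ := t₁.of_shift
      cases γ <;> cases e
      refine ⟨_, .closeR t₁' (.res (α := .inp _) t₂), ?_⟩
      refine .trans (.trans (.resSwap _) ?_) (Struct.congRes (.extrude _ _)).symm
      simp only [Act.underRes, Act.up, PiProc.rename, rename_upSucc_swap]
      exact .refl _
  | opening t =>
    cases t with
    | parL _ t =>
      obtain ⟨γ, P', e, rfl, t⟩ := t.of_shift
      cases γ <;> cases e
    | parR _ t => exact ⟨_, .parR _ (.opening t), .refl _⟩

/-- A visible transition of `!P` is one of a copy of `P`. -/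
theorem rep_trans_visible {P Q : PiProc} {α : Act} (h : Trans (rep P) α Q) (hα : α ≠ .tau) :
    ∃ P', Trans P α P' ∧ Struct Q (par P' (α.bystander (rep P))) := by
  generalize e : rep P = R at h
  -- The premise of the replication rule has the subject `P | !P`, so the induction on derivations
  -- treats both shapes at once.
  suffices H : ∀ R Q, Trans R α Q → (R = rep P ∨ R = par P (rep P)) →
      ∃ P', Trans P α P' ∧ Struct Q (par P' (α.bystander (rep P))) from
    e ▸ H _ _ h (.inl e.symm)
  clear h e Q R
  intro R Q h hR
  induction h with
  | rep _ ih =>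
    rcases hR with e | e <;> cases e
    exact ih hα (.inr rfl)
  | parL _ t _ =>
    rcases hR with e | e <;> cases e
    exact ⟨_, t, .refl _⟩
  | @parR _ _ β _ _ ih =>
    rcases hR with e | e <;> cases e
    obtain ⟨P', t, s⟩ := ih hα (.inl rfl)
    refine ⟨P', t, (s.parR _).trans ((Struct.parLeftComm _ _ _).trans (.parR _ ?_))⟩
    rw [← Act.bystander_par]
    exact (Struct.repUnfold P).symm.bystander β
  | _ => rcases hR with e | e <;> cases e <;> exact absurd rfl hα

/-- A transition of `!P` involves at most two copies of `P`. -/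
theorem rep_trans {P Q : PiProc} {α : Act} (h : Trans (rep P) α Q) :
    ∃ P', Trans (par P P) α P' ∧ Struct Q (par P' (α.bystander (rep P))) := by
  suffices H : ∀ R Q, Trans R α Q → (R = rep P ∨ R = par P (rep P)) →
      ∃ P', Trans (par P P) α P' ∧ Struct Q (par P' (α.bystander (rep P))) from
    H _ _ h (.inl rfl)
  clear h Q
  intro R Q h hR
  induction h with
  | rep _ ih =>
    rcases hR with e | e <;> cases e
    exact ih (.inr rfl)
  | @parL _ _ β _ t _ =>
    rcases hR with e | e <;> cases e
    refine ⟨_, .parL _ t, .trans (.parR _ ?_) (.parAssoc _ _ _)⟩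
    rw [← Act.bystander_par]
    exact (Struct.repUnfold P).bystander β
  | @parR _ _ β _ _ ih =>
    rcases hR with e | e <;> cases e
    obtain ⟨P', t, s⟩ := ih (.inl rfl)
    refine ⟨P', t, (s.parR _).trans ((Struct.parLeftComm _ _ _).trans (.parR _ ?_))⟩
    rw [← Act.bystander_par]
    exact (Struct.repUnfold P).symm.bystander β
  | commL t₁ t₂ =>
    rcases hR with e | e <;> cases e
    obtain ⟨P', t, s⟩ := rep_trans_visible t₂ (by simp)
    exact ⟨_, .commL t₁ t, (s.parR _).trans (.parAssoc _ _ _)⟩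
  | commR t₁ t₂ =>
    rcases hR with e | e <;> cases e
    obtain ⟨P', t, s⟩ := rep_trans_visible t₂ (by simp)
    refine ⟨_, .commR t₁ t, ((s.rename _).parR _).trans (.trans ?_ (.parAssoc _ _ _))⟩
    change Struct (par _ (inst _ (par P' (rep P).shift))) _
    rw [inst_par, inst_shift]
    exact .refl _
  | closeL t₁ t₂ =>
    rcases hR with e | e <;> cases e
    obtain ⟨P', t, s⟩ := rep_trans_visible t₂ (by simp)
    exact ⟨_, .closeL t₁ t, (Struct.congRes ((s.parR _).trans (.parAssoc _ _ _))).trans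
      (Struct.extrudeL _ _).symm⟩
  | closeR t₁ t₂ =>
    rcases hR with e | e <;> cases e
    obtain ⟨P', t, s⟩ := rep_trans_visible t₂ (by simp)
    exact ⟨_, .closeR t₁ t, (Struct.congRes ((s.parR _).trans (.parAssoc _ _ _))).trans
      (Struct.extrudeL _ _).symm⟩
  | _ => rcases hR with e | e <;> cases e

theorem Simulates.parAssoc_symm (P Q R : PiProc) :
    Simulates (.par (.par P Q) R) (.par P (.par Q R)) :=
  (Simulates.parComm _ _).trans <|
    ((Simulates.refl R).par (.parComm P Q) (.refl R) (.parComm P Q)).trans <|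
    (Simulates.parAssoc R Q P).trans <| (Simulates.parComm _ _).trans <|
    (Simulates.refl P).par (.parComm R Q) (.refl P) (.parComm R Q)

theorem Simulates.rep_fold (P : PiProc) : Simulates (.par P (rep P)) (rep P) :=
  fun _ X t => ⟨X, .rep t, .refl X⟩

/-- A direct induction would meet `!P` again in the premise. Instead `rep_trans` reduces a
transition of `!P` to one of two copies of `P`, where the congruence for parallel composition
applies. -/
theorem Simulates.rep {P P' : PiProc} (h : Simulates P P') (s : Struct P P') :
    Simulates (rep P) (rep P') := by
  intro α X t
  obtain ⟨Y, t, sY⟩ := rep_trans t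
  obtain ⟨Y', t', sY'⟩ := h.par h s s _ _ t
  -- The two copies that were unfolded are absorbed again by the replication.
  have fold : Simulates (.par (.par P' P') (.rep P')) (.rep P') :=
    (Simulates.parAssoc_symm P' P' (.rep P')).trans
      (((Simulates.refl P').par (.rep_fold P') (.refl P') (Struct.repUnfold P').symm).trans
        (.rep_fold P'))
  obtain ⟨Z, tZ, sZ⟩ := fold _ _ (.parL (.rep P') t')
  exact ⟨Z, tZ, sY.trans ((Struct.congPar sY' ((Struct.congRep s).bystander α)).trans sZ)⟩

/-- Structural equivalence is a strong bisimulation. -/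
theorem Struct.simulates {P Q : PiProc} (h : Struct P Q) : Simulates P Q ∧ Simulates Q P := by
  induction h with
  | refl P => exact ⟨.refl P, .refl P⟩
  | symm _ ih => exact ih.symm
  | trans _ _ ih₁ ih₂ => exact ⟨ih₁.1.trans ih₂.1, ih₂.2.trans ih₁.2⟩
  | congPar s₁ s₂ ih₁ ih₂ => exact ⟨ih₁.1.par ih₂.1 s₁ s₂, ih₁.2.par ih₂.2 s₁.symm s₂.symm⟩
  | congRep s ih => exact ⟨ih.1.rep s, ih.2.rep s.symm⟩
  | congRes _ ih => exact ⟨ih.1.res, ih.2.res⟩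
  | congInp s _ =>
    refine ⟨fun α X t => ?_, fun α X t => ?_⟩ <;> cases t
    · exact ⟨_, .inp _ _, s⟩
    · exact ⟨_, .inp _ _, s.symm⟩
  | congOut s _ =>
    refine ⟨fun α X t => ?_, fun α X t => ?_⟩ <;> cases t
    · exact ⟨_, .out _ _ _, s⟩
    · exact ⟨_, .out _ _ _, s.symm⟩
  | parNil P => exact ⟨.parNil P, .parNil_symm P⟩
  | parComm P Q => exact ⟨.parComm P Q, .parComm Q P⟩
  | parAssoc P Q R => exact ⟨.parAssoc P Q R, .parAssoc_symm P Q R⟩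
  | repUnfold P =>
    refine ⟨fun α X t => ?_, .rep_fold P⟩
    cases t with
    | rep t => exact ⟨X, t, .refl X⟩
  | resNil =>
    refine ⟨fun α X t => ?_, fun α X t => ?_⟩
    · cases t with
      | res t => cases t
      | opening t => cases t
    · cases t
  | resSwap P =>
    refine ⟨.resSwap P, ?_⟩
    have := Simulates.resSwap (P.rename swapName)
    rwa [swap_swap] at this
  | extrude P Q => exact ⟨.extrude P Q, .extrude_symm P Q⟩

theorem Struct.exists_trans {P Q P' : PiProc} {α : Act} (h : Struct P Q) (t : Trans P α P') :
    ∃ Q', Trans Q α Q' ∧ Struct P' Q' := h.simulates.1 α P' t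

/-- Every reduction is an internal transition, up to structural equivalence. -/
theorem Red.exists_trans {P P' : PiProc} (h : Red P P') :
    ∃ Q, Trans P .tau Q ∧ Struct Q P' := by
  induction h with
  | comm a c P Q => exact ⟨_, .commL (.inp a P) (.out a c Q), .refl _⟩
  | par Q _ ih =>
    obtain ⟨X, t, s⟩ := ih
    exact ⟨_, .parL Q t, s.parL _⟩
  | res _ ih =>
    obtain ⟨X, t, s⟩ := ih
    exact ⟨_, .res (α := .tau) t, .congRes s⟩
  | struct s₁ _ s₂ ih =>
    obtain ⟨X, t, s⟩ := ih
    obtain ⟨Y, t', s'⟩ := s₁.symm.exists_trans t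
    exact ⟨Y, t', s'.symm.trans (s.trans s₂)⟩

end PiProc

/-! ### Weak bisimilarity is an equivalence -/

theorem TauMany.parL {P P' : PiProc} (Q : PiProc) (h : TauMany P P') :
    TauMany (.par P Q) (.par P' Q) := by
  induction h with
  | refl => exact .refl
  | tail _ t ih => exact ih.tail (.parL Q t)

theorem TauMany.res {P P' : PiProc} (h : TauMany P P') : TauMany (.res P) (.res P') := by
  induction h with
  | refl => exact .refl
  | tail _ t ih => exact ih.tail (.res (α := .tau) t)

theorem TauMany.exists_of_struct {P Q P' : PiProc} (s : P.Struct Q) (h : TauMany P P') :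
    ∃ Q', TauMany Q Q' ∧ P'.Struct Q' := by
  induction h with
  | refl => exact ⟨Q, .refl, s⟩
  | tail _ t ih =>
    obtain ⟨Q₁, h₁, s₁⟩ := ih
    obtain ⟨Q₂, t₂, s₂⟩ := s₁.exists_trans t
    exact ⟨Q₂, h₁.tail t₂, s₂⟩

theorem IsWeakSim.tauMany {R : PiProc → PiProc → Prop} (h : IsWeakSim R) {P Q P' : PiProc}
    (r : R P Q) (t : TauMany P P') : ∃ Q', TauMany Q Q' ∧ R P' Q' := by
  induction t with
  | refl => exact ⟨Q, .refl, r⟩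
  | tail _ t ih =>
    obtain ⟨Q₁, h₁, r₁⟩ := ih
    obtain ⟨Q₂, h₂, r₂⟩ := h.tau r₁ t
    exact ⟨Q₂, h₁.trans h₂, r₂⟩

theorem IsWeakSim.comp {R S : PiProc → PiProc → Prop} (hR : IsWeakSim R) (hS : IsWeakSim S) :
    IsWeakSim (fun P Q => ∃ X, R P X ∧ S X Q) where
  tau := by
    rintro P Q P' ⟨X, r, s⟩ t
    obtain ⟨X', tX, r'⟩ := hR.tau r t
    obtain ⟨Q', tQ, s'⟩ := hS.tauMany s tX
    exact ⟨Q', tQ, X', r', s'⟩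
  out := by
    rintro P Q P' a b ⟨X, r, s⟩ t
    obtain ⟨X₁, X₂, X', t₁, t₂, t₃, r'⟩ := hR.out r t
    obtain ⟨Q₁, u₁, s₁⟩ := hS.tauMany s t₁
    obtain ⟨Q₂, Q₃, Q₄, u₂, u₃, u₄, s₂⟩ := hS.out s₁ t₂
    obtain ⟨Q', u₅, s₃⟩ := hS.tauMany s₂ t₃
    exact ⟨Q₂, Q₃, Q', u₁.trans u₂, u₃, u₄.trans u₅, X', r', s₃⟩
  bout := by
    rintro P Q P' a ⟨X, r, s⟩ t
    obtain ⟨X₁, X₂, X', t₁, t₂, t₃, r'⟩ := hR.bout r t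
    obtain ⟨Q₁, u₁, s₁⟩ := hS.tauMany s t₁
    obtain ⟨Q₂, Q₃, Q₄, u₂, u₃, u₄, s₂⟩ := hS.bout s₁ t₂
    obtain ⟨Q', u₅, s₃⟩ := hS.tauMany s₂ t₃
    exact ⟨Q₂, Q₃, Q', u₁.trans u₂, u₃, u₄.trans u₅, X', r', s₃⟩
  inp := by
    rintro P Q P' a ⟨X, r, s⟩ t
    obtain ⟨X₁, X₂, t₁, t₂, h⟩ := hR.inp r t
    obtain ⟨Q₁, u₁, s₁⟩ := hS.tauMany s t₁
    obtain ⟨Q₂, Q₃, u₂, u₃, h'⟩ := hS.inp s₁ t₂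
    -- In the late discipline the input derivative is fixed before the received name `b` is known.
    refine ⟨Q₂, Q₃, u₁.trans u₂, u₃, fun b => ?_⟩
    obtain ⟨X', t₃, r'⟩ := h b
    obtain ⟨Q₄, u₄, s₂⟩ := h' b
    obtain ⟨Q', u₅, s₃⟩ := hS.tauMany s₂ t₃
    exact ⟨Q', u₄.trans u₅, X', r', s₃⟩
  ok := by
    rintro P Q P' ⟨X, r, s⟩ t
    obtain ⟨X₁, X₂, X', t₁, t₂, t₃, r'⟩ := hR.ok r t
    obtain ⟨Q₁, u₁, s₁⟩ := hS.tauMany s t₁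
    obtain ⟨Q₂, Q₃, Q₄, u₂, u₃, u₄, s₂⟩ := hS.ok s₁ t₂
    obtain ⟨Q', u₅, s₃⟩ := hS.tauMany s₂ t₃
    exact ⟨Q₂, Q₃, Q', u₁.trans u₂, u₃, u₄.trans u₅, X', r', s₃⟩

theorem WeakBisimilar.symm {P Q : PiProc} : WeakBisimilar P Q → WeakBisimilar Q P :=
  fun ⟨R, h₁, h₂, r⟩ => ⟨fun P Q => R Q P, h₂, h₁, r⟩

theorem WeakBisimilar.trans {P Q X : PiProc} :
    WeakBisimilar P Q → WeakBisimilar Q X → WeakBisimilar P X := by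
  rintro ⟨R, h₁, h₂, r⟩ ⟨S, k₁, k₂, s⟩
  refine ⟨_, h₁.comp k₁, ?_, Q, r, s⟩
  have := k₂.comp h₂
  simpa only [and_comm] using this

theorem BehEquiv.symm {P Q : PiProc} (h : BehEquiv P Q) : BehEquiv Q P := fun σ => (h σ).symm

theorem BehEquiv.trans {P Q X : PiProc} (h : BehEquiv P Q) (k : BehEquiv Q X) : BehEquiv P X :=
  fun σ => (h σ).trans (k σ)

/-! ### Expansions -/

/-- `R` is a graded expansion: `R n X Y` means that `X` behaves like `Y`, except that it needs
further internal transitions, at most `n` of which can happen without a transition of `Y`. -/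
structure IsExpansion (R : ℕ → PiProc → PiProc → Prop) : Prop where
  rename : ∀ {n X Y} (σ : ℕ → ℕ), R n X Y → R n (X.rename σ) (Y.rename σ)
  forth : ∀ {n X Y α X'}, R n X Y → Trans X α X' →
    (α = .tau ∧ ∃ m < n, R m X' Y) ∨ ∃ m Y', Trans Y α Y' ∧ R m X' Y'
  back : ∀ {n X Y α Y'}, R n X Y → Trans Y α Y' →
    ∃ X₁ X' m, TauMany X X₁ ∧ Trans X₁ α X' ∧ R m X' Y'

/-- The closure of a graded relation under structural equivalence. -/
def UpToStruct (R : ℕ → PiProc → PiProc → Prop) (n : ℕ) (X Y : PiProc) : Prop :=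
  ∃ X' Y', X.Struct X' ∧ R n X' Y' ∧ Y'.Struct Y

theorem UpToStruct.of {R : ℕ → PiProc → PiProc → Prop} {n : ℕ} {X Y : PiProc} (h : R n X Y) :
    UpToStruct R n X Y := ⟨X, Y, .refl X, h, .refl Y⟩

theorem UpToStruct.of_struct {R : ℕ → PiProc → PiProc → Prop} {n : ℕ} {X X' Y Y' : PiProc}
    (s : X.Struct X') (h : UpToStruct R n X' Y') (s' : Y'.Struct Y) : UpToStruct R n X Y := by
  obtain ⟨X₁, Y₁, s₁, r, s₂⟩ := h
  exact ⟨X₁, Y₁, s.trans s₁, r, s₂.trans s'⟩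

/-- Since structural equivalence is a strong bisimulation, it matches transitions one for one and
leaves the grades untouched; derivatives therefore need to be related only up to it. -/
theorem IsExpansion.upToStruct {R : ℕ → PiProc → PiProc → Prop}
    (rename : ∀ {n X Y} (σ : ℕ → ℕ), R n X Y → R n (X.rename σ) (Y.rename σ))
    (forth : ∀ {n X Y α X'}, R n X Y → Trans X α X' →
      (α = .tau ∧ ∃ m < n, UpToStruct R m X' Y) ∨ ∃ m Y', Trans Y α Y' ∧ UpToStruct R m X' Y')
    (back : ∀ {n X Y α Y'}, R n X Y → Trans Y α Y' →
      ∃ X₁ X' m, TauMany X X₁ ∧ Trans X₁ α X' ∧ UpToStruct R m X' Y') :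
    IsExpansion (UpToStruct R) where
  rename := by
    rintro n X Y σ ⟨X', Y', s, r, s'⟩
    exact ⟨_, _, s.rename σ, rename σ r, s'.rename σ⟩
  forth := by
    rintro n X Y α X' ⟨X₁, Y₁, s, r, s'⟩ t
    obtain ⟨X₂, t₂, s₂⟩ := s.exists_trans t
    rcases forth r t₂ with ⟨e, m, hm, u⟩ | ⟨m, Y₂, t₃, u⟩
    · exact .inl ⟨e, m, hm, u.of_struct s₂ s'⟩
    · obtain ⟨Y₃, t₄, s₄⟩ := s'.exists_trans t₃
      exact .inr ⟨m, Y₃, t₄, u.of_struct s₂ s₄⟩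
  back := by
    rintro n X Y α Y' ⟨X₁, Y₁, s, r, s'⟩ t
    obtain ⟨Y₂, t₂, s₂⟩ := s'.symm.exists_trans t
    obtain ⟨X₂, X₃, m, t₃, t₄, u⟩ := back r t₂
    obtain ⟨X₄, t₅, s₅⟩ := t₃.exists_of_struct s.symm
    obtain ⟨X₅, t₆, s₆⟩ := s₅.exists_trans t₄
    exact ⟨X₄, X₅, m, t₅, t₆, u.of_struct s₆.symm s₂.symm⟩

/-- `X` expands `Y`. -/
def Expands (X Y : PiProc) : Prop := ∃ R n, IsExpansion R ∧ R n X Y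

theorem Expands.of_struct {X Y : PiProc} (h : X.Struct Y) : Expands X Y := by
  refine ⟨fun _ X Y => X.Struct Y, 0, ⟨fun σ h => h.rename σ, fun h t => ?_, fun h t => ?_⟩, h⟩
  · obtain ⟨Y', t', s⟩ := h.exists_trans t
    exact .inr ⟨0, Y', t', s⟩
  · obtain ⟨X', t', s⟩ := h.symm.exists_trans t
    exact ⟨_, X', 0, .refl, t', s.symm⟩

/-- The closure of a graded relation under evaluation contexts. -/
inductive EvalClosure (R : ℕ → PiProc → PiProc → Prop) : ℕ → PiProc → PiProc → Prop
  | base {n : ℕ} {X Y : PiProc} : R n X Y → EvalClosure R n X Y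
  | par {n : ℕ} {X Y : PiProc} (Z : PiProc) :
      EvalClosure R n X Y → EvalClosure R n (.par X Z) (.par Y Z)
  | res {n : ℕ} {X Y : PiProc} : EvalClosure R n X Y → EvalClosure R n (.res X) (.res Y)

theorem EvalClosure.rename {R : ℕ → PiProc → PiProc → Prop} (hR : IsExpansion R) {n : ℕ}
    {X Y : PiProc} (h : EvalClosure R n X Y) (σ : ℕ → ℕ) :
    EvalClosure R n (X.rename σ) (Y.rename σ) := by
  induction h generalizing σ with
  | base r => exact .base (hR.rename σ r)
  | par Z _ ih => exact .par _ (ih σ)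
  | res _ ih => exact .res (ih _)

theorem EvalClosure.underRes {R : ℕ → PiProc → PiProc → Prop} (hR : IsExpansion R) {n : ℕ}
    {X Y : PiProc} (h : EvalClosure R n X Y) (α : Act) :
    EvalClosure R n (α.underRes X) (α.underRes Y) := by
  cases α <;> first | exact h | exact h.rename hR _

theorem EvalClosure.bystander {R : ℕ → PiProc → PiProc → Prop} (hR : IsExpansion R) {n : ℕ}
    {X Y : PiProc} (h : EvalClosure R n X Y) (α : Act) :
    EvalClosure R n (α.bystander X) (α.bystander Y) := by
  cases α <;> first | exact h | exact h.rename hR _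

/-- Only an internal move of the innermost process alone can lack a counterpart. Moves of the
surrounding context are copied, and visible actions used in a communication are always matched, so
the context does not affect the bound on unmatched moves. -/
theorem EvalClosure.forth {R : ℕ → PiProc → PiProc → Prop} (hR : IsExpansion R) {n : ℕ}
    {X Y X' : PiProc} {α : Act} (h : EvalClosure R n X Y) (t : Trans X α X') :
    (α = .tau ∧ ∃ m < n, EvalClosure R m X' Y) ∨
      ∃ m Y', Trans Y α Y' ∧ EvalClosure R m X' Y' := by
  induction h generalizing α X' with
  | base r =>
    rcases hR.forth r t with ⟨e, m, hm, r'⟩ | ⟨m, Y', t', r'⟩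
    · exact .inl ⟨e, m, hm, .base r'⟩
    · exact .inr ⟨m, Y', t', .base r'⟩
  | par Z h ih =>
    cases t with
    | parL _ t =>
      rcases ih t with ⟨rfl, m, hm, r'⟩ | ⟨m, Y', t', r'⟩
      · exact .inl ⟨rfl, m, hm, .par _ r'⟩
      · exact .inr ⟨m, _, .parL _ t', .par _ r'⟩
    | parR _ t => exact .inr ⟨_, _, .parR _ t, .par _ (h.bystander hR _)⟩
    | commL t₁ t₂ =>
      obtain ⟨m, Y', t', r'⟩ := (ih t₁).resolve_left (by simp)
      exact .inr ⟨m, _, .commL t' t₂, .par _ (r'.rename hR _)⟩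
    | commR t₁ t₂ =>
      obtain ⟨m, Y', t', r'⟩ := (ih t₁).resolve_left (by simp)
      exact .inr ⟨m, _, .commR t' t₂, .par _ r'⟩
    | closeL t₁ t₂ =>
      obtain ⟨m, Y', t', r'⟩ := (ih t₁).resolve_left (by simp)
      exact .inr ⟨m, _, .closeL t' t₂, .res (.par _ r')⟩
    | closeR t₁ t₂ =>
      obtain ⟨m, Y', t', r'⟩ := (ih t₁).resolve_left (by simp)
      exact .inr ⟨m, _, .closeR t' t₂, .res (.par _ r')⟩
  | res h ih =>
    cases t with
    | res t =>
      rcases ih t with ⟨e, m, hm, r'⟩ | ⟨m, Y', t', r'⟩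
      · cases α <;> cases e
        exact .inl ⟨rfl, m, hm, .res r'⟩
      · exact .inr ⟨m, _, .res t', .res (r'.underRes hR α)⟩
    | opening t =>
      obtain ⟨m, Y', t', r'⟩ := (ih t).resolve_left (by simp)
      exact .inr ⟨m, _, .opening t', r'⟩

theorem EvalClosure.back {R : ℕ → PiProc → PiProc → Prop} (hR : IsExpansion R) {n : ℕ}
    {X Y Y' : PiProc} {α : Act} (h : EvalClosure R n X Y) (t : Trans Y α Y') :
    ∃ X₁ X' m, TauMany X X₁ ∧ Trans X₁ α X' ∧ EvalClosure R m X' Y' := by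
  induction h generalizing α Y' with
  | base r =>
    obtain ⟨X₁, X', m, t₁, t₂, r'⟩ := hR.back r t
    exact ⟨X₁, X', m, t₁, t₂, .base r'⟩
  | par Z h ih =>
    cases t with
    | parL _ t =>
      obtain ⟨X₁, X', m, t₁, t₂, r'⟩ := ih t
      exact ⟨_, _, m, t₁.parL _, .parL _ t₂, .par _ r'⟩
    | parR _ t => exact ⟨_, _, _, .refl, .parR _ t, .par _ (h.bystander hR _)⟩
    | commL t t' =>
      obtain ⟨X₁, X', m, t₁, t₂, r'⟩ := ih t
      exact ⟨_, _, m, t₁.parL _, .commL t₂ t', .par _ (r'.rename hR _)⟩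
    | commR t t' =>
      obtain ⟨X₁, X', m, t₁, t₂, r'⟩ := ih t
      exact ⟨_, _, m, t₁.parL _, .commR t₂ t', .par _ r'⟩
    | closeL t t' =>
      obtain ⟨X₁, X', m, t₁, t₂, r'⟩ := ih t
      exact ⟨_, _, m, t₁.parL _, .closeL t₂ t', .res (.par _ r')⟩
    | closeR t t' =>
      obtain ⟨X₁, X', m, t₁, t₂, r'⟩ := ih t
      exact ⟨_, _, m, t₁.parL _, .closeR t₂ t', .res (.par _ r')⟩
  | res h ih =>
    cases t with
    | res t =>
      obtain ⟨X₁, X', m, t₁, t₂, r'⟩ := ih t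
      exact ⟨_, _, m, t₁.res, .res t₂, .res (r'.underRes hR α)⟩
    | opening t =>
      obtain ⟨X₁, X', m, t₁, t₂, r'⟩ := ih t
      exact ⟨_, _, m, t₁.res, .opening t₂, r'⟩

theorem IsExpansion.evalClosure {R : ℕ → PiProc → PiProc → Prop} (hR : IsExpansion R) :
    IsExpansion (EvalClosure R) :=
  ⟨fun σ h => h.rename hR σ, fun h t => h.forth hR t, fun h t => h.back hR t⟩

theorem Expands.par {X Y : PiProc} (h : Expands X Y) (Z : PiProc) :
    Expands (.par X Z) (.par Y Z) := by
  obtain ⟨R, n, hR, r⟩ := h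
  exact ⟨_, n, hR.evalClosure, .par Z (.base r)⟩

theorem Expands.res {X Y : PiProc} (h : Expands X Y) : Expands (.res X) (.res Y) := by
  obtain ⟨R, n, hR, r⟩ := h
  exact ⟨_, n, hR.evalClosure, .res (.base r)⟩

/-- Forgetting the grades leaves a weak bisimulation. Closure of expansions under renaming accounts
both for received names and for the outer substitution. -/
theorem Expands.behEquiv {X Y : PiProc} (h : Expands X Y) : BehEquiv X Y := by
  obtain ⟨R, n, hR, r⟩ := h
  refine fun σ => ⟨fun X Y => ∃ n, R n X Y, ⟨?_, ?_, ?_, ?_, ?_⟩, ⟨?_, ?_, ?_, ?_, ?_⟩,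
    n, hR.rename σ r⟩
  · rintro P Q P' ⟨n, r⟩ t
    rcases hR.forth r t with ⟨-, m, -, r'⟩ | ⟨m, Y', t', r'⟩
    · exact ⟨Q, .refl, m, r'⟩
    · exact ⟨Y', .single t', m, r'⟩
  · rintro P Q P' a b ⟨n, r⟩ t
    obtain ⟨m, Y', t', r'⟩ := (hR.forth r t).resolve_left (by simp)
    exact ⟨Q, Y', Y', .refl, t', .refl, m, r'⟩
  · rintro P Q P' a ⟨n, r⟩ t
    obtain ⟨m, Y', t', r'⟩ := (hR.forth r t).resolve_left (by simp)
    exact ⟨Q, Y', Y', .refl, t', .refl, m, r'⟩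
  · rintro P Q P' a ⟨n, r⟩ t
    obtain ⟨m, Y', t', r'⟩ := (hR.forth r t).resolve_left (by simp)
    exact ⟨Q, Y', .refl, t', fun b => ⟨_, .refl, m, hR.rename _ r'⟩⟩
  · rintro P Q P' ⟨n, r⟩ t
    obtain ⟨m, Y', t', r'⟩ := (hR.forth r t).resolve_left (by simp)
    exact ⟨Q, Y', Y', .refl, t', .refl, m, r'⟩
  · rintro P Q P' ⟨n, r⟩ t
    obtain ⟨X₁, X', m, t₁, t₂, r'⟩ := hR.back r t
    exact ⟨X', t₁.tail t₂, m, r'⟩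
  · rintro P Q P' a b ⟨n, r⟩ t
    obtain ⟨X₁, X', m, t₁, t₂, r'⟩ := hR.back r t
    exact ⟨X₁, X', X', t₁, t₂, .refl, m, r'⟩
  · rintro P Q P' a ⟨n, r⟩ t
    obtain ⟨X₁, X', m, t₁, t₂, r'⟩ := hR.back r t
    exact ⟨X₁, X', X', t₁, t₂, .refl, m, r'⟩
  · rintro P Q P' a ⟨n, r⟩ t
    obtain ⟨X₁, X', m, t₁, t₂, r'⟩ := hR.back r t
    exact ⟨X₁, X', t₁, t₂, fun b => ⟨_, .refl, m, hR.rename _ r'⟩⟩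
  · rintro P Q P' ⟨n, r⟩ t
    obtain ⟨X₁, X', m, t₁, t₂, r'⟩ := hR.back r t
    exact ⟨X₁, X', X', t₁, t₂, .refl, m, r'⟩

theorem BehEquiv.refl (P : PiProc) : BehEquiv P P := (Expands.of_struct (.refl P)).behEquiv

/-- `X` has only finite sequences of internal transitions. -/
def Terminates (X : PiProc) : Prop := Acc (fun X' X => Trans X .tau X') X

/-- Lexicographic induction: a move of `X` either is a move of `Y`, which terminates, or lowers the
grade. -/
theorem Expands.terminates {X Y : PiProc} (h : Expands X Y) (hY : Terminates Y) :
    Terminates X := by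
  obtain ⟨R, n, hR, r⟩ := h
  induction hY generalizing n X with
  | intro Y _ ih =>
    induction n using Nat.strong_induction_on generalizing X with
    | _ n ihn =>
      refine ⟨X, fun X' t => ?_⟩
      rcases hR.forth r t with ⟨-, m, hm, r'⟩ | ⟨m, Y', t', r'⟩
      · exact ihn m hm r'
      · exact ih Y' t' m r'

/-- `X'` is reached from `X` by `n` internal transitions. -/
inductive TauSteps : ℕ → PiProc → PiProc → Prop
  | refl (X : PiProc) : TauSteps 0 X X
  | head {n : ℕ} {X X₁ X' : PiProc} : Trans X .tau X₁ → TauSteps n X₁ X' → TauSteps (n + 1) X X'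

/-- That the number of steps does not grow is what makes the induction in
`Conf.behEquiv_of_tauSteps` well founded. -/
theorem Expands.exists_tauSteps {X Y X' : PiProc} {n : ℕ} (h : Expands X Y)
    (t : TauSteps n X X') : ∃ m ≤ n, ∃ Y', TauSteps m Y Y' ∧ Expands X' Y' := by
  obtain ⟨R, k, hR, r⟩ := h
  induction t generalizing k Y with
  | refl X => exact ⟨0, le_rfl, Y, .refl Y, R, k, hR, r⟩
  | head t _ ih =>
    rcases hR.forth r t with ⟨-, j, -, r'⟩ | ⟨j, Y₁, t₁, r'⟩
    · obtain ⟨m, hm, Y', t', e⟩ := ih j r'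
      exact ⟨m, by omega, Y', t', e⟩
    · obtain ⟨m, hm, Y', t', e⟩ := ih j r'
      exact ⟨m + 1, by omega, Y', .head t₁ t', e⟩

/-- The transitive closure of expansion. -/
def ExpandsMany : PiProc → PiProc → Prop := Relation.ReflTransGen Expands

namespace ExpandsMany

theorem refl (X : PiProc) : ExpandsMany X X := Relation.ReflTransGen.refl

theorem trans {X Y Z : PiProc} (h : ExpandsMany X Y) (k : ExpandsMany Y Z) : ExpandsMany X Z :=
  Relation.ReflTransGen.trans h k

theorem of_struct {X Y : PiProc} (h : X.Struct Y) : ExpandsMany X Y := .single (.of_struct h)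

theorem par {X Y : PiProc} (h : ExpandsMany X Y) (Z : PiProc) :
    ExpandsMany (.par X Z) (.par Y Z) := by
  induction h with
  | refl => exact refl _
  | tail _ e ih => exact ih.trans (.single (e.par Z))

theorem res {X Y : PiProc} (h : ExpandsMany X Y) : ExpandsMany (.res X) (.res Y) := by
  induction h with
  | refl => exact refl _
  | tail _ e ih => exact ih.trans (.single e.res)

theorem parR {X Y : PiProc} (Z : PiProc) (h : ExpandsMany X Y) :
    ExpandsMany (.par Z X) (.par Z Y) :=
  (of_struct (.parComm _ _)).trans ((h.par Z).trans (of_struct (.parComm _ _)))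

theorem behEquiv {X Y : PiProc} (h : ExpandsMany X Y) : BehEquiv X Y := by
  induction h with
  | refl => exact .refl X
  | tail _ e ih => exact ih.trans e.behEquiv

theorem terminates {X Y : PiProc} (h : ExpandsMany X Y) (hY : Terminates Y) : Terminates X := by
  induction h using Relation.ReflTransGen.head_induction_on with
  | refl => exact hY
  | head e _ ih => exact e.terminates ih

theorem exists_tauSteps {X Y X' : PiProc} {n : ℕ} (h : ExpandsMany X Y) (t : TauSteps n X X') :
    ∃ m ≤ n, ∃ Y', TauSteps m Y Y' ∧ ExpandsMany X' Y' := by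
  induction h with
  | refl => exact ⟨n, le_rfl, X', t, refl X'⟩
  | tail _ e ih =>
    obtain ⟨m, hm, Y', t', h'⟩ := ih
    obtain ⟨k, hk, Z', t'', e'⟩ := e.exists_tauSteps t'
    exact ⟨k, hk.trans hm, Z', t'', h'.trans (.single e')⟩

end ExpandsMany

/-- If the only transition of `D`, under any renaming, is an internal one to `D'`, then `D` expands
`D'`. -/
theorem Expands.of_deterministic {D D' : PiProc}
    (h : ∀ (σ : ℕ → ℕ) (α : Act) (X : PiProc), Trans (D.rename σ) α X →
      α = .tau ∧ X.Struct (D'.rename σ))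
    {X₀ : PiProc} (t₀ : Trans D .tau X₀) : Expands D D' := by
  have s₀ : X₀.Struct D' := by
    have := h id
    rw [PiProc.rename_id, PiProc.rename_id] at this
    exact (this _ _ t₀).2
  -- Grade `1` holds the renamings of `D` before their single move, grade `0` the identity relation
  -- afterwards.
  let R : ℕ → PiProc → PiProc → Prop := fun n X Y =>
    (n = 0 ∧ X = Y) ∨ (n = 1 ∧ ∃ σ, X = D.rename σ ∧ Y = D'.rename σ)
  refine ⟨UpToStruct R, 1, IsExpansion.upToStruct ?_ ?_ ?_,
    .of (.inr ⟨rfl, id, D.rename_id.symm, D'.rename_id.symm⟩)⟩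
  · rintro n X Y σ (⟨rfl, rfl⟩ | ⟨rfl, τ, rfl, rfl⟩)
    · exact .inl ⟨rfl, rfl⟩
    · exact .inr ⟨rfl, σ ∘ τ, PiProc.rename_rename _ _ _, PiProc.rename_rename _ _ _⟩
  · rintro n X Y α X' (⟨rfl, rfl⟩ | ⟨rfl, τ, rfl, rfl⟩) t
    · exact .inr ⟨0, X', t, .of (.inl ⟨rfl, rfl⟩)⟩
    · obtain ⟨e, s⟩ := h _ _ _ t
      exact .inl ⟨e, 0, one_pos, _, _, s, .inl ⟨rfl, rfl⟩, .refl _⟩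
  · rintro n X Y α Y' (⟨rfl, rfl⟩ | ⟨rfl, τ, rfl, rfl⟩) t
    · exact ⟨X, Y', 0, .refl, t, .of (.inl ⟨rfl, rfl⟩)⟩
    · obtain ⟨Z, t', s⟩ := (s₀.rename τ).symm.exists_trans t
      exact ⟨_, Z, 0, .single (t₀.rename τ), t', _, _, s.symm, .inl ⟨rfl, rfl⟩, .refl _⟩

/-! ### Inversion of transitions -/

theorem Trans.res_inv {P X : PiProc} {α : Act} (h : Trans (.res P) α X) :
    (∃ P', Trans P α.shift P' ∧ X = .res (α.underRes P')) ∨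
      ∃ a, α = .bout a ∧ Trans P (.out (a + 1) 0) X := by
  cases h with
  | res t => exact .inl ⟨_, t, rfl⟩
  | opening t => exact .inr ⟨_, rfl, t⟩

theorem Trans.inp_inv {a : ℕ} {P X : PiProc} {α : Act} (h : Trans (.inp a P) α X) :
    α = .inp a ∧ X = P := by
  cases h; exact ⟨rfl, rfl⟩

theorem Trans.out_inv {a b : ℕ} {P X : PiProc} {α : Act} (h : Trans (.out a b P) α X) :
    α = .out a b ∧ X = P := by
  cases h; exact ⟨rfl, rfl⟩

theorem Trans.resOut_inv {a : ℕ} {P X : PiProc} {α : Act}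
    (h : Trans (.res (.out (a + 1) 0 P)) α X) : α = .bout a ∧ X = P := by
  rcases h.res_inv with ⟨P', t, -⟩ | ⟨b, rfl, t⟩
  · obtain ⟨e, -⟩ := t.out_inv
    cases α <;> cases e
  · obtain ⟨e, rfl⟩ := t.out_inv
    cases e
    exact ⟨rfl, rfl⟩

theorem Trans.resOut (a : ℕ) (P : PiProc) : Trans (.res (.out (a + 1) 0 P)) (.bout a) P :=
  .opening (.out _ _ _)

theorem Trans.repInp_inv {a : ℕ} {B X : PiProc} {α : Act} (h : Trans (.rep (.inp a B)) α X) :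
    α = .inp a ∧ X.Struct (.par B (PiProc.rep (.inp a B)).shift) := by
  by_cases hα : α = .tau
  · subst hα
    obtain ⟨P', t, -⟩ := PiProc.rep_trans h
    cases t with
    | parL _ t => cases t
    | parR _ t => cases t
    | commL _ t => cases t
    | commR t _ => cases t
    | closeL _ t => cases t
    | closeR t _ => cases t
  · obtain ⟨P', t, s⟩ := PiProc.rep_trans_visible h hα
    cases t
    exact ⟨rfl, s⟩

theorem Trans.repInp (a : ℕ) (B : PiProc) :
    Trans (.rep (.inp a B)) (.inp a) (.par B (PiProc.rep (.inp a B)).shift) :=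
  .rep (.parL _ (.inp a B))

theorem Act.shift_ne_inp_zero (α : Act) : α.shift ≠ .inp 0 := by
  cases α <;> simp [Act.shift]

theorem Act.shift_ne_bout_zero (α : Act) : α.shift ≠ .bout 0 := by
  cases α <;> simp [Act.shift]

theorem Act.shift_ne_out_zero (α : Act) (b : ℕ) : α.shift ≠ .out 0 b := by
  cases α <;> simp [Act.shift]

theorem Act.shift_eq_tau {α : Act} (h : α.shift = .tau) : α = .tau := by
  cases α <;> simp_all [Act.shift]

/-! ### Internal communications on private names -/

/-- Communication of a private name over a private linear channel. -/
theorem Expands.linear_bout (A B : PiProc) :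
    Expands (.res (.par (.inp 0 A) (.res (.out 1 0 B)))) (.res (.res (.par A B))) := by
  refine .of_deterministic (fun σ α X t₀ => ?_)
    (.res (α := .tau) (.closeL (.inp _ _) (.resOut _ _)))
  simp only [PiProc.rename, upName_zero, upName_one] at t₀ ⊢
  rcases t₀.res_inv with ⟨Z, t, rfl⟩ | ⟨a, rfl, t⟩
  · generalize e : α.shift = β at t
    cases t with
    | parL _ t => exact absurd (e.trans t.inp_inv.1) α.shift_ne_inp_zero
    | parR _ t => exact absurd (e.trans t.resOut_inv.1) α.shift_ne_bout_zero
    | commL _ t => cases t.resOut_inv.1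
    | commR t _ => cases t
    | closeL t₁ t₂ =>
      obtain rfl := Act.shift_eq_tau e
      obtain ⟨e₁, rfl⟩ := t₁.inp_inv
      obtain ⟨e₂, rfl⟩ := t₂.resOut_inv
      exact ⟨rfl, .refl _⟩
    | closeR t _ => cases t
  · cases t with
    | parL _ t => cases t
    | parR _ t => cases t.resOut_inv.1

/-- A call of a private server with a private name. -/
theorem Expands.server_call (B C : PiProc) :
    Expands (.res (.par (.res (.out 1 0 C)) (.rep (.inp 0 B))))
      (.res (.res (.par C (.par B (PiProc.rep (.inp 0 B)).shift)))) := by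
  refine .of_deterministic (fun σ α X t₀ => ?_)
    (.res (α := .tau) (.closeR (.resOut _ _) (.repInp _ _)))
  rw [PiProc.rename, PiProc.rename, PiProc.rename, PiProc.rename, PiProc.shift_rename]
  simp only [PiProc.rename, upName_zero, upName_one] at t₀ ⊢
  rcases t₀.res_inv with ⟨Z, t, rfl⟩ | ⟨a, rfl, t⟩
  · generalize e : α.shift = β at t
    cases t with
    | parL _ t => exact absurd (e.trans t.resOut_inv.1) α.shift_ne_bout_zero
    | parR _ t => exact absurd (e.trans t.repInp_inv.1) α.shift_ne_inp_zero
    | commL _ t => cases t.repInp_inv.1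
    | commR t _ => cases t.resOut_inv.1
    | closeL t _ => cases t.resOut_inv.1
    | closeR t₁ t₂ =>
      obtain rfl := Act.shift_eq_tau e
      obtain ⟨e₁, rfl⟩ := t₁.resOut_inv
      obtain ⟨e₂, s⟩ := t₂.repInp_inv
      exact ⟨rfl, .congRes (.congRes (s.parR _))⟩
  · cases t with
    | parL _ t => cases t.resOut_inv.1
    | parR _ t => cases t.repInp_inv.1

/-- Communication over a private linear channel. -/
theorem Expands.linear_out (b : ℕ) (A B : PiProc) :
    Expands (.res (.par (.out 0 b A) (.inp 0 B))) (.res (.par A (B.inst b))) := by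
  refine .of_deterministic (fun σ α X t₀ => ?_)
    (.res (α := .tau) (.commR (.out _ _ _) (.inp _ _)))
  rw [PiProc.rename, PiProc.rename, PiProc.inst_rename]
  simp only [PiProc.rename, upName_zero] at t₀ ⊢
  rcases t₀.res_inv with ⟨Z, t, rfl⟩ | ⟨a, rfl, t⟩
  · generalize e : α.shift = β at t
    cases t with
    | parL _ t => exact absurd (e.trans t.out_inv.1) (α.shift_ne_out_zero _)
    | parR _ t => exact absurd (e.trans t.inp_inv.1) α.shift_ne_inp_zero
    | commL t _ => cases t
    | commR t₁ t₂ =>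
      obtain rfl := Act.shift_eq_tau e
      obtain ⟨e₁, rfl⟩ := t₁.out_inv
      obtain ⟨e₂, rfl⟩ := t₂.inp_inv
      cases e₁
      exact ⟨rfl, .refl _⟩
    | closeL t _ => cases t
    | closeR t _ => cases t
  · cases t with
    | parL _ t => cases t
    | parR _ t => cases t

/-! ### Inlining of a private server -/

open PiProc

/-- `Inlined k B n P P'`: the name `k` occurs in `P` only in calls `k⟨b⟩.0`, and `P'` is obtained
from `P` by replacing each of them by the body `B` of the server `!k(w).B`; `n` calls are active. -/
inductive Inlined : ℕ → PiProc → ℕ → PiProc → PiProc → Prop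
  | nil {k : ℕ} {B : PiProc} : Inlined k B 0 .nil .nil
  | ok {k : ℕ} {B : PiProc} : Inlined k B 0 .ok .ok
  | par {k n m : ℕ} {B P P' Q Q' : PiProc} :
      Inlined k B n P P' → Inlined k B m Q Q' → Inlined k B (n + m) (.par P Q) (.par P' Q')
  | rep {k : ℕ} {B P P' : PiProc} : Inlined k B 0 P P' → Inlined k B 0 (.rep P) (.rep P')
  | res {k n : ℕ} {B P P' : PiProc} :
      Inlined (k + 1) (B.rename (upName Nat.succ)) n P P' → Inlined k B n (.res P) (.res P')
  | inp {k a n : ℕ} {B P P' : PiProc} : a ≠ k →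
      Inlined (k + 1) (B.rename (upName Nat.succ)) n P P' →
      Inlined k B 0 (.inp a P) (.inp a P')
  | out {k a b n : ℕ} {B P P' : PiProc} : a ≠ k → b ≠ k → Inlined k B n P P' →
      Inlined k B 0 (.out a b P) (.out a b P')
  | call {k b : ℕ} {B : PiProc} : b ≠ k → Inlined k B 1 (.out k b .nil) (B.inst b)

namespace Inlined

theorem congr {k n k' n' : ℕ} {B P P' B' Q Q' : PiProc} (h : Inlined k B n P P') (hk : k = k')
    (hn : n = n') (hB : B = B') (hP : P = Q) (hP' : P' = Q') : Inlined k' B' n' Q Q' := by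
  subst hk hn hB hP hP'; exact h

theorem refl_of_notMem {k : ℕ} (B : PiProc) {P : PiProc} (h : k ∉ P.fn) : Inlined k B 0 P P := by
  induction P generalizing k B with
  | nil => exact .nil
  | ok => exact .ok
  | par P Q ihP ihQ =>
    simp only [fn, Set.mem_union, not_or] at h
    exact .par (ihP B h.1) (ihQ B h.2)
  | rep P ih => exact .rep (ih B h)
  | res P ih => exact .res (ih _ h)
  | inp a P ih =>
    simp only [fn, Set.mem_union, Set.mem_singleton_iff, not_or] at h
    exact .inp (Ne.symm h.1) (ih _ h.2)
  | out a b P ih =>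
    simp only [fn, Set.mem_union, Set.mem_insert_iff, Set.mem_singleton_iff, not_or] at h
    exact .out (Ne.symm h.1.1) (Ne.symm h.1.2) (ih _ h.2)

/-- The renaming need not be injective: it suffices that no other name is identified with that of
the server. This is what allows the instantiation of received names. -/
theorem rename {k n : ℕ} {B P P' : PiProc} (h : Inlined k B n P P') {σ : ℕ → ℕ}
    (hσ : ∀ a, a ≠ k → σ a ≠ σ k) :
    Inlined (σ k) (B.rename (upName σ)) n (P.rename σ) (P'.rename σ) := by
  have up : ∀ {k : ℕ} {σ : ℕ → ℕ}, (∀ a, a ≠ k → σ a ≠ σ k) →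
      ∀ a, a ≠ k + 1 → upName σ a ≠ upName σ (k + 1) := by
    rintro k σ hσ (_ | a) ha
    · simp
    · simpa using hσ a (by simpa using ha)
  have comm : ∀ (B : PiProc) (σ : ℕ → ℕ),
      (B.rename (upName Nat.succ)).rename (upName (upName σ)) =
        (B.rename (upName σ)).rename (upName Nat.succ) := by
    intro B σ
    simp only [rename_rename, upName_comp]
    rfl
  induction h generalizing σ with
  | nil => exact .nil
  | ok => exact .ok
  | par _ _ ih₁ ih₂ => exact .par (ih₁ hσ) (ih₂ hσ)
  | rep _ ih => exact .rep (ih hσ)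
  | res _ ih => exact .res ((ih (up hσ)).congr rfl rfl (comm _ _) rfl rfl)
  | inp ha _ ih => exact .inp (hσ _ ha) ((ih (up hσ)).congr rfl rfl (comm _ _) rfl rfl)
  | out ha hb _ ih => exact .out (hσ _ ha) (hσ _ hb) (ih hσ)
  | call hb => rw [inst_rename]; exact .call (hσ _ hb)

theorem inst {k n : ℕ} {B P P' : PiProc}
    (h : Inlined (k + 1) (B.rename (upName Nat.succ)) n P P') {b : ℕ} (hb : b ≠ k) :
    Inlined k B n (P.inst b) (P'.inst b) := by
  refine (h.rename (σ := instName b) ?_).congr rfl rfl ?_ rfl rfl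
  · rintro (_ | a) ha
    · exact hb
    · simpa using ha
  · rw [rename_rename, upName_comp]
    exact rename_eq_self (by rintro (_ | n) <;> rfl) B

theorem shift {k n : ℕ} {B P P' : PiProc} (h : Inlined k B n P P') :
    Inlined (k + 1) (B.rename (upName Nat.succ)) n P.shift P'.shift :=
  h.rename fun _ ha => by simpa using ha

theorem swap {k n : ℕ} {B P P' : PiProc}
    (h : Inlined (k + 2) ((B.rename (upName Nat.succ)).rename (upName Nat.succ)) n P P') :
    Inlined (k + 2) ((B.rename (upName Nat.succ)).rename (upName Nat.succ)) n
      (P.rename swapName) (P'.rename swapName) := by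
  refine (h.rename (σ := swapName) ?_).congr rfl rfl ?_ rfl rfl
  · rintro (_ | _ | a) ha <;> simp
    simpa using ha
  · simp only [rename_rename, upName_comp]; rfl

/-- Together with `not_out_object` this says that the server has no rival and that its name never
leaks: no communication inside `P` takes place on `k`, and none transmits `k`. -/
theorem not_inp {k n : ℕ} {B P P' X : PiProc} {α : Act} (h : Inlined k B n P P')
    (t : Trans P α X) : α ≠ .inp k := by
  induction t generalizing k B n P' with
  | inp a P => cases h with | inp ha _ => simpa using ha
  | parL _ _ ih => cases h with | par h₁ h₂ => exact ih h₁
  | parR _ _ ih => cases h with | par h₁ h₂ => exact ih h₂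
  | @res _ _ α _ ih =>
    cases h with
    | res h => intro e; exact ih h (by rw [e]; rfl)
  | rep _ ih => cases h with | rep h => exact ih (h.par h.rep)
  | _ => simp

theorem not_out_object {k n : ℕ} {B P P' X : PiProc} {α : Act} (h : Inlined k B n P P')
    (t : Trans P α X) (a : ℕ) : α ≠ .out a k := by
  induction t generalizing k B n P' a with
  | out a b P =>
    cases h with
    | out _ hb _ => simp [hb]
    | call hb => simp [hb]
  | parL _ _ ih => cases h with | par h₁ h₂ => exact ih h₁ a
  | parR _ _ ih => cases h with | par h₁ h₂ => exact ih h₂ a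
  | @res _ _ α _ ih =>
    cases h with
    | res h => intro e; exact ih h (a + 1) (by rw [e]; rfl)
  | rep _ ih => cases h with | rep h => exact ih (h.par h.rep) a
  | _ => simp

/-- A name below the binder of an action (if there is one). -/
def _root_.LambdaPi.Act.shiftName : Act → ℕ → ℕ
  | .bout _ => Nat.succ
  | .inp _ => Nat.succ
  | _ => id

theorem bystander {k n : ℕ} {B P P' : PiProc} (h : Inlined k B n P P') (α : Act) :
    Inlined (α.shiftName k) (B.rename (upName α.shiftName)) n (α.bystander P)
      (α.bystander P') := by
  cases α <;> first
  | exact h.shift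
  | exact h.congr rfl rfl (by simp only [upName_id, rename_id, Act.shiftName]) rfl rfl

theorem underRes {k n : ℕ} {B P P' : PiProc} (α : Act)
    (h : Inlined (α.shift.shiftName (k + 1))
      ((B.rename (upName Nat.succ)).rename (upName α.shift.shiftName)) n P P') :
    Inlined (α.shiftName k + 1) ((B.rename (upName α.shiftName)).rename (upName Nat.succ)) n
      (α.underRes P) (α.underRes P') := by
  cases α <;> first
  | exact h.swap
  | exact h.congr rfl rfl (by simp only [Act.shiftName, Act.shift, upName_id, rename_id]) rfl rfl

theorem keep {k n : ℕ} {B P P' : PiProc} (h : Inlined k B n P P') :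
    Inlined (id k) (B.rename (upName id)) n P P' := by
  rwa [upName_id, rename_id]

theorem keep' {k n : ℕ} {B P P' : PiProc} (h : Inlined (id k) (B.rename (upName id)) n P P') :
    Inlined k B n P P' := by
  rwa [upName_id, rename_id] at h

/-- Transitions that are not calls survive inlining. -/
theorem forth {k n : ℕ} {B P P' X : PiProc} {α : Act} (h : Inlined k B n P P')
    (t : Trans P α X) (h₁ : ∀ b, α ≠ .out k b) (h₂ : α ≠ .bout k) :
    ∃ m X', Trans P' α X' ∧ Inlined (α.shiftName k) (B.rename (upName α.shiftName)) m X X' := by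
  induction t generalizing k B n P' with
  | inp a P => cases h with | inp ha h => exact ⟨_, _, .inp _ _, h⟩
  | out a b P =>
    cases h with
    | out _ hb h => exact ⟨_, _, .out _ _ _, keep h⟩
    | call hb => exact absurd rfl (h₁ _)
  | ok => cases h with | ok => exact ⟨_, _, .ok, .ok⟩
  | parL _ _ ih =>
    cases h with
    | par hP hQ =>
      obtain ⟨m, X', t', r⟩ := ih hP h₁ h₂
      exact ⟨_, _, .parL _ t', r.par (hQ.bystander _)⟩
  | parR _ _ ih =>
    cases h with
    | par hP hQ =>
      obtain ⟨m, X', t', r⟩ := ih hQ h₁ h₂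
      exact ⟨_, _, .parR _ t', (hP.bystander _).par r⟩
  | commL t₁ t₂ ih₁ ih₂ =>
    cases h with
    | par hP hQ =>
      have ha := hP.not_inp t₁
      have hb := fun a => hQ.not_out_object t₂ a
      obtain ⟨m₁, X₁, u₁, r₁⟩ := ih₁ hP (by simp) (by simp)
      obtain ⟨m₂, X₂, u₂, r₂⟩ := ih₂ hQ (by simpa using ha) (by simp)
      exact ⟨_, _, .commL u₁ u₂, keep ((inst r₁ (by simpa using hb)).par (keep' r₂))⟩
  | commR t₁ t₂ ih₁ ih₂ =>
    cases h with
    | par hP hQ =>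
      have ha := hQ.not_inp t₂
      have hb := fun a => hP.not_out_object t₁ a
      obtain ⟨m₁, X₁, u₁, r₁⟩ := ih₁ hP (by simpa using ha) (by simp)
      obtain ⟨m₂, X₂, u₂, r₂⟩ := ih₂ hQ (by simp) (by simp)
      exact ⟨_, _, .commR u₁ u₂, keep ((keep' r₁).par (inst r₂ (by simpa using hb)))⟩
  | closeL t₁ t₂ ih₁ ih₂ =>
    cases h with
    | par hP hQ =>
      have ha := hP.not_inp t₁
      obtain ⟨m₁, X₁, u₁, r₁⟩ := ih₁ hP (by simp) (by simp)
      obtain ⟨m₂, X₂, u₂, r₂⟩ := ih₂ hQ (by simp) (by simpa using ha)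
      exact ⟨_, _, .closeL u₁ u₂, keep (.res (r₁.par r₂))⟩
  | closeR t₁ t₂ ih₁ ih₂ =>
    cases h with
    | par hP hQ =>
      have ha := hQ.not_inp t₂
      obtain ⟨m₁, X₁, u₁, r₁⟩ := ih₁ hP (by simp) (by simpa using ha)
      obtain ⟨m₂, X₂, u₂, r₂⟩ := ih₂ hQ (by simp) (by simp)
      exact ⟨_, _, .closeR u₁ u₂, keep (.res (r₁.par r₂))⟩
  | @res _ _ α _ ih =>
    cases h with
    | res h =>
      obtain ⟨m, X', t', r⟩ := ih h
        (by cases α <;> (simp [Act.shift]; try rintro (_ | b) <;> simp_all))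
        (by cases α <;> simp_all [Act.shift])
      exact ⟨m, _, .res t', .res (r.underRes α)⟩
  | @opening _ _ a t ih =>
    cases h with
    | res h =>
      obtain ⟨m, X', t', r⟩ := ih h (by simpa using h₂) (by simp)
      exact ⟨m, _, .opening t', keep' r⟩
  | rep _ ih =>
    cases h with
    | rep h =>
      obtain ⟨m, X', t', r⟩ := ih (h.par h.rep) h₁ h₂
      exact ⟨m, _, .rep t', r⟩

/-- Grade `0` rules out an active call at the top, whose inlined body could have any shape. Hence
this inversion and those below can read off the shape of `P` from the inlined process. -/
theorem ok_inv {k : ℕ} {B P : PiProc} (h : Inlined k B 0 P .ok) : P = .ok := by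
  generalize hz : 0 = z at h
  generalize hR : PiProc.ok = R at h
  cases h <;> first | (cases hz; done) | cases hR
  rfl

theorem par_inv {k : ℕ} {B P P' Q' : PiProc} (h : Inlined k B 0 P (.par P' Q')) :
    ∃ P₁ Q₁, P = .par P₁ Q₁ ∧ Inlined k B 0 P₁ P' ∧ Inlined k B 0 Q₁ Q' := by
  generalize hz : 0 = z at h
  generalize hR : PiProc.par P' Q' = R at h
  cases h <;> first | (cases hz; done) | cases hR
  rename_i n m P Q hP hQ
  obtain ⟨rfl, rfl⟩ : n = 0 ∧ m = 0 := by omega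
  exact ⟨P, Q, rfl, hP, hQ⟩

theorem rep_inv {k : ℕ} {B P P' : PiProc} (h : Inlined k B 0 P (.rep P')) :
    ∃ P₁, P = .rep P₁ ∧ Inlined k B 0 P₁ P' := by
  generalize hz : 0 = z at h
  generalize hR : PiProc.rep P' = R at h
  cases h <;> first | (cases hz; done) | cases hR
  exact ⟨_, rfl, by assumption⟩

theorem res_inv {k : ℕ} {B P P' : PiProc} (h : Inlined k B 0 P (.res P')) :
    ∃ P₁, P = .res P₁ ∧ Inlined (k + 1) (B.rename (upName Nat.succ)) 0 P₁ P' := by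
  generalize hz : 0 = z at h
  generalize hR : PiProc.res P' = R at h
  cases h <;> first | (cases hz; done) | cases hR
  subst hz
  exact ⟨_, rfl, by assumption⟩

theorem inp_inv {k a : ℕ} {B P P' : PiProc} (h : Inlined k B 0 P (.inp a P')) :
    ∃ n P₁, P = .inp a P₁ ∧ a ≠ k ∧ Inlined (k + 1) (B.rename (upName Nat.succ)) n P₁ P' := by
  generalize hz : 0 = z at h
  generalize hR : PiProc.inp a P' = R at h
  cases h <;> first | (cases hz; done) | cases hR
  exact ⟨_, _, rfl, by assumption, by assumption⟩

theorem out_inv {k a b : ℕ} {B P P' : PiProc} (h : Inlined k B 0 P (.out a b P')) :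
    ∃ n P₁, P = .out a b P₁ ∧ a ≠ k ∧ b ≠ k ∧ Inlined k B n P₁ P' := by
  generalize hz : 0 = z at h
  generalize hR : PiProc.out a b P' = R at h
  cases h <;> first | (cases hz; done) | cases hR
  exact ⟨_, _, rfl, by assumption, by assumption, by assumption⟩

theorem shift_notMem {k : ℕ} {B : PiProc} (h : k + 1 ∉ B.fn) :
    k + 1 + 1 ∉ (B.rename (upName Nat.succ)).fn := by
  rw [mem_fn_rename]
  rintro ⟨_ | m, hm, e⟩
  · simp at e
  · simp only [upName_succ, Nat.succ_eq_add_one, Nat.add_right_cancel_iff] at e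
    exact h (e ▸ hm)

/-- Without active calls, inlining adds no transitions. -/
theorem back {k : ℕ} {B P P' X' : PiProc} {α : Act} (h : Inlined k B 0 P P')
    (t : Trans P' α X') :
    ∃ m X, Trans P α X ∧ Inlined (α.shiftName k) (B.rename (upName α.shiftName)) m X X' := by
  induction t generalizing k B P with
  | inp a P =>
    obtain ⟨n, Q, rfl, ha, h⟩ := h.inp_inv
    exact ⟨_, _, .inp _ _, h⟩
  | out a b P =>
    obtain ⟨n, Q, rfl, ha, hb, h⟩ := h.out_inv
    exact ⟨_, _, .out _ _ _, keep h⟩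
  | ok =>
    obtain rfl := h.ok_inv
    exact ⟨_, _, .ok, .ok⟩
  | parL _ _ ih =>
    obtain ⟨P, Q, rfl, hP, hQ⟩ := h.par_inv
    obtain ⟨m, X, t, r⟩ := ih hP
    exact ⟨_, _, .parL _ t, r.par (hQ.bystander _)⟩
  | parR _ _ ih =>
    obtain ⟨P, Q, rfl, hP, hQ⟩ := h.par_inv
    obtain ⟨m, X, t, r⟩ := ih hQ
    exact ⟨_, _, .parR _ t, (hP.bystander _).par r⟩
  | commL _ _ ih₁ ih₂ =>
    obtain ⟨P, Q, rfl, hP, hQ⟩ := h.par_inv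
    obtain ⟨m₁, X₁, u₁, r₁⟩ := ih₁ hP
    obtain ⟨m₂, X₂, u₂, r₂⟩ := ih₂ hQ
    have hb := fun a => hQ.not_out_object u₂ a
    exact ⟨_, _, .commL u₁ u₂, keep ((inst r₁ (by simpa using hb)).par (keep' r₂))⟩
  | commR _ _ ih₁ ih₂ =>
    obtain ⟨P, Q, rfl, hP, hQ⟩ := h.par_inv
    obtain ⟨m₁, X₁, u₁, r₁⟩ := ih₁ hP
    obtain ⟨m₂, X₂, u₂, r₂⟩ := ih₂ hQ
    have hb := fun a => hP.not_out_object u₁ a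
    exact ⟨_, _, .commR u₁ u₂, keep ((keep' r₁).par (inst r₂ (by simpa using hb)))⟩
  | closeL _ _ ih₁ ih₂ =>
    obtain ⟨P, Q, rfl, hP, hQ⟩ := h.par_inv
    obtain ⟨m₁, X₁, u₁, r₁⟩ := ih₁ hP
    obtain ⟨m₂, X₂, u₂, r₂⟩ := ih₂ hQ
    exact ⟨_, _, .closeL u₁ u₂, keep (.res (r₁.par r₂))⟩
  | closeR _ _ ih₁ ih₂ =>
    obtain ⟨P, Q, rfl, hP, hQ⟩ := h.par_inv
    obtain ⟨m₁, X₁, u₁, r₁⟩ := ih₁ hP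
    obtain ⟨m₂, X₂, u₂, r₂⟩ := ih₂ hQ
    exact ⟨_, _, .closeR u₁ u₂, keep (.res (r₁.par r₂))⟩
  | @res _ _ α _ ih =>
    obtain ⟨P, rfl, h'⟩ := h.res_inv
    obtain ⟨m, X, t, r⟩ := ih h'
    exact ⟨m, _, .res t, .res (r.underRes α)⟩
  | opening _ ih =>
    obtain ⟨P, rfl, h'⟩ := h.res_inv
    obtain ⟨m, X, t, r⟩ := ih h'
    exact ⟨m, _, .opening t, keep' r⟩
  | rep _ ih =>
    obtain ⟨P, rfl, h'⟩ := h.rep_inv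
    obtain ⟨m, X, t, r⟩ := ih (h'.par h'.rep)
    exact ⟨m, _, .rep t, r⟩

/-- A call `k⟨b⟩` of the server leaves its body behind, as in the inlined process. -/
theorem call_out {k n b : ℕ} {B P P' X : PiProc} (h : Inlined k B n P P') (hB : k + 1 ∉ B.fn)
    (t : Trans P (.out k b) X) :
    ∃ m X', n = m + 1 ∧ (PiProc.par X (B.inst b)).Struct X' ∧ Inlined k B m X' P' := by
  have hbk : b ≠ k := fun e => h.not_out_object t k (by rw [e])
  generalize eα : Act.out k b = α at t
  induction t generalizing k n b B P' with
  | out a c P =>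
    cases eα
    cases h with
    | out ha => exact absurd rfl ha
    | call hb =>
      -- The body does not call its own server and `b ≠ k`, so the instantiated body avoids `k` and
      -- is its own inlining.
      refine ⟨0, _, rfl, .nilPar _, refl_of_notMem _ ?_⟩
      rw [PiProc.inst, mem_fn_rename]
      rintro ⟨_ | m, hm, e⟩
      · exact hb e
      · obtain rfl : m = _ := e
        exact hB hm
  | parL _ _ ih =>
    subst eα
    cases h with
    | par hP hQ =>
      obtain ⟨m, X', rfl, s, r⟩ := ih hP hB hbk rfl
      exact ⟨_, _, Nat.add_right_comm _ _ _, (Struct.parRightComm _ _ _).trans (s.parL _),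
        r.par hQ⟩
  | parR _ _ ih =>
    subst eα
    cases h with
    | par hP hQ =>
      obtain ⟨m, X', rfl, s, r⟩ := ih hQ hB hbk rfl
      exact ⟨_, _, (Nat.add_assoc _ _ _).symm, (Struct.parAssoc _ _ _).symm.trans (s.parR _),
        hP.par r⟩
  | @res _ _ α _ ih =>
    subst eα
    cases h with
    | res h =>
      obtain ⟨m, X', rfl, s, r⟩ := ih h (shift_notMem hB) (by simpa using hbk) rfl
      rw [upSucc_inst] at s
      exact ⟨m, _, rfl, (Struct.extrudeL _ _).trans (.congRes s), .res r⟩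
  | rep _ ih =>
    cases h with
    | rep h =>
      obtain ⟨m, X', e, -⟩ := ih (h.par h.rep) hB hbk eα
      -- A replicated process has no active calls, so it cannot perform one.
      omega
  | _ => cases eα

/-- A call of the server with a private name leaves its body behind, as in the inlined process. -/
theorem call_bout {k n : ℕ} {B P P' X : PiProc} (h : Inlined k B n P P') (hB : k + 1 ∉ B.fn)
    (t : Trans P (.bout k) X) :
    ∃ m X', n = m + 1 ∧ (PiProc.res (.par X B)).Struct X' ∧ Inlined k B m X' P' := by
  generalize eα : Act.bout k = α at t
  induction t generalizing k n B P' with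
  | parL Q _ ih =>
    subst eα
    cases h with
    | par hP hQ =>
      obtain ⟨m, X', rfl, s, r⟩ := ih hP hB rfl
      exact ⟨_, _, Nat.add_right_comm _ _ _,
        (Struct.congRes (.parRightComm _ _ _)).trans
          ((Struct.extrudeL _ Q).symm.trans (s.parL _)), r.par hQ⟩
  | parR Q _ ih =>
    subst eα
    cases h with
    | par hP hQ =>
      obtain ⟨m, X', rfl, s, r⟩ := ih hQ hB rfl
      exact ⟨_, _, (Nat.add_assoc _ _ _).symm,
        (Struct.congRes (Struct.parAssoc _ _ _).symm).trans
          ((Struct.extrude Q _).symm.trans (s.parR _)), hP.par r⟩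
  | @res _ _ α _ ih =>
    subst eα
    cases h with
    | res h =>
      obtain ⟨m, X', rfl, s, r⟩ := ih h (shift_notMem hB) rfl
      refine ⟨m, _, rfl, .trans ?_ (.congRes s), .res r⟩
      refine .trans (.congRes (.extrudeL _ _)) (.trans (.resSwap _) ?_)
      simp only [Act.underRes, PiProc.rename, swap_swap, shift_swap]
      exact .refl _
  | opening t =>
    cases eα
    cases h with
    | res h =>
      obtain ⟨m, X', rfl, s, r⟩ := h.call_out (shift_notMem hB) t
      rw [upSucc_inst_zero] at s
      exact ⟨m, _, rfl, .congRes s, .res r⟩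
  | rep _ ih =>
    cases h with
    | rep h =>
      obtain ⟨m, X', e, -⟩ := ih (h.par h.rep) hB eα
      omega
  | _ => cases eα

/-- Active calls can be performed. -/
theorem exists_call {k n : ℕ} {B P P' : PiProc} (h : Inlined k B (n + 1) P P') :
    (∃ b X, Trans P (.out k b) X) ∨ ∃ X, Trans P (.bout k) X := by
  generalize e : n + 1 = z at h
  induction h generalizing n with
  | @par _ i _ _ _ _ _ _ _ _ ih₁ ih₂ =>
    cases i with
    | zero =>
      rcases ih₂ (n := n) (by omega) with ⟨b, X, t⟩ | ⟨X, t⟩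
      · exact .inl ⟨b, _, .parR _ t⟩
      · exact .inr ⟨_, .parR _ t⟩
    | succ i =>
      rcases ih₁ rfl with ⟨b, X, t⟩ | ⟨X, t⟩
      · exact .inl ⟨b, _, .parL _ t⟩
      · exact .inr ⟨_, .parL _ t⟩
  | res _ ih =>
    rcases ih e with ⟨_ | b, X, t⟩ | ⟨X, t⟩
    · exact .inr ⟨_, .opening t⟩
    · exact .inl ⟨b, _, .res (α := .out _ b) t⟩
    · exact .inr ⟨_, .res (α := .bout _) t⟩
  | call _ => exact .inl ⟨_, _, .out _ _ _⟩
  | _ => cases e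

end Inlined

/-- A process together with a private server. -/
def withServer (P B : PiProc) : PiProc := .res (.par P (.rep (.inp 0 B)))

/-- The relation between processes with a private server and the processes where it is inlined. -/
def ServerInlined (n : ℕ) (X Y : PiProc) : Prop :=
  ∃ B P P', 1 ∉ B.fn ∧ Inlined 0 B n P P' ∧ X = withServer P B ∧ Y = .res P'

theorem notMem_fn_rename_upUp {B : PiProc} (h : 1 ∉ B.fn) (σ : ℕ → ℕ) :
    1 ∉ (B.rename (upName (upName σ))).fn := by
  rw [mem_fn_rename]
  rintro ⟨_ | _ | m, hm, e⟩
  · simp at e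
  · exact h hm
  · simp at e

theorem ServerInlined.rename {n : ℕ} {X Y : PiProc} (h : ServerInlined n X Y) (σ : ℕ → ℕ) :
    ServerInlined n (X.rename σ) (Y.rename σ) := by
  obtain ⟨B, P, P', hB, h, rfl, rfl⟩ := h
  refine ⟨B.rename (upName (upName σ)), _, _, notMem_fn_rename_upUp hB σ,
    h.rename (σ := upName σ) ?_, rfl, rfl⟩
  rintro (_ | a) ha
  · exact absurd rfl ha
  · simp

/-- If the action has a binder, this binder is moved past the restriction of the server, whose body
is weakened accordingly; the server keeps the index `0`. -/
theorem ServerInlined.of_underRes {n : ℕ} {B Q Q' : PiProc} {α : Act} (hB : 1 ∉ B.fn)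
    (r : Inlined (α.shift.shiftName 0) (B.rename (upName α.shift.shiftName)) n Q Q') :
    ServerInlined n
      (.res (α.underRes (PiProc.par Q (α.shift.bystander (PiProc.rep (.inp 0 B))))))
      (.res (α.underRes Q')) := by
  have binder : ∀ {m : ℕ} {Q Q' : PiProc}, Inlined 1 (B.rename (upName Nat.succ)) m Q Q' →
      ServerInlined m
        (.res ((PiProc.par Q (PiProc.rep (.inp 0 B)).shift).rename swapName))
        (.res (Q'.rename swapName)) := by
    intro m Q Q' r
    refine ⟨B.rename (upName (upName Nat.succ)), Q.rename swapName, _,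
      notMem_fn_rename_upUp hB _, (r.rename (σ := swapName) ?_).congr rfl rfl ?_ rfl rfl,
      ?_, rfl⟩
    · rintro (_ | _ | a) ha <;> simp at ha ⊢
    · rw [rename_rename, upName_comp]
      congr 2; funext n; cases n <;> rfl
    · rw [withServer, PiProc.rename, shift_swap]; rfl
  cases α with
  | bout a => exact binder r
  | inp a => exact binder r
  | _ => exact ⟨B, _, _, hB, r.keep', rfl, rfl⟩

theorem withServer_out_struct {X X' Z B : PiProc} {b : ℕ}
    (s : Z.Struct (.par B (PiProc.rep (.inp 0 B)).shift))
    (s' : (PiProc.par X (B.inst b)).Struct X') :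
    (PiProc.res (.par X (Z.inst b))).Struct (withServer X' B) := by
  refine .congRes (.trans (.parR X (s.rename (instName b))) ?_)
  change PiProc.Struct (.par X (.par (B.inst b) ((PiProc.rep (.inp 0 B)).shift.inst b))) _
  rw [inst_shift]
  exact (Struct.parAssoc _ _ _).trans (s'.parL _)

theorem withServer_bout_struct {X X' Z B : PiProc}
    (s : Z.Struct (.par B (PiProc.rep (.inp 0 B)).shift))
    (s' : (PiProc.res (.par X B)).Struct X') :
    (PiProc.res (.res (.par X Z))).Struct (withServer X' B) :=
  .congRes (.trans (.congRes (.trans (s.parR X) (.parAssoc _ _ _)))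
    (.trans (Struct.extrudeL _ _).symm (s'.parL _)))

/-- A move that does not involve the server survives inlining. A call turns an active call into a
copy of the body, which is already present on the right, so the right side stays put and the grade
drops by one. The server alone shows no action, as its name is private. -/
theorem ServerInlined.forth {n : ℕ} {X Y X' : PiProc} {α : Act} (h : ServerInlined n X Y)
    (t : Trans X α X') :
    (α = .tau ∧ ∃ m < n, UpToStruct ServerInlined m X' Y) ∨
      ∃ m Y', Trans Y α Y' ∧ UpToStruct ServerInlined m X' Y' := by
  obtain ⟨B, P, P', hB, h, rfl, rfl⟩ := h
  rcases t.res_inv with ⟨Z, t₁, rfl⟩ | ⟨a, rfl, t₁⟩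
  · generalize e : α.shift = β at t₁
    cases t₁ with
    | parL _ t₂ =>
      subst e
      obtain ⟨m, Y, t₃, r⟩ := h.forth t₂ (fun b => α.shift_ne_out_zero b) α.shift_ne_bout_zero
      refine .inr ⟨m, _, .res t₃, .of ?_⟩
      exact .of_underRes hB r
    | parR _ t₂ => exact absurd (e.trans t₂.repInp_inv.1) α.shift_ne_inp_zero
    | commL _ t₂ => cases t₂.repInp_inv.1
    | closeL _ t₂ => cases t₂.repInp_inv.1
    | commR t₂ t₃ =>
      obtain rfl := Act.shift_eq_tau e
      obtain ⟨e₁, s⟩ := t₃.repInp_inv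
      cases e₁
      obtain ⟨m, X', rfl, s', r⟩ := h.call_out hB t₂
      exact .inl ⟨rfl, m, Nat.lt_succ_self m, _, _, withServer_out_struct s s',
        ⟨B, X', P', hB, r, rfl, rfl⟩, .refl _⟩
    | closeR t₂ t₃ =>
      obtain rfl := Act.shift_eq_tau e
      obtain ⟨e₁, s⟩ := t₃.repInp_inv
      cases e₁
      obtain ⟨m, X', rfl, s', r⟩ := h.call_bout hB t₂
      exact .inl ⟨rfl, m, Nat.lt_succ_self m, _, _, withServer_bout_struct s s',
        ⟨B, X', P', hB, r, rfl, rfl⟩, .refl _⟩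
  · cases t₁ with
    -- Opening the restriction would require the name of the server to be sent as an object.
    | parL _ t₂ => exact absurd rfl (h.not_out_object t₂ (a + 1))
    | parR _ t₂ => cases t₂.repInp_inv.1

theorem Inlined.exists_tau {n : ℕ} {B P P' : PiProc} (h : Inlined 0 B (n + 1) P P')
    (hB : 1 ∉ B.fn) :
    ∃ Z X, Trans (withServer P B) .tau Z ∧ Z.Struct (withServer X B) ∧ Inlined 0 B n X P' := by
  rcases h.exists_call with ⟨b, X, t⟩ | ⟨X, t⟩
  · obtain ⟨m, X', e, s, r⟩ := h.call_out hB t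
    obtain rfl : n = m := by omega
    exact ⟨_, X', .res (α := .tau) (.commR t (.repInp 0 B)), withServer_out_struct (.refl _) s, r⟩
  · obtain ⟨m, X', e, s, r⟩ := h.call_bout hB t
    obtain rfl : n = m := by omega
    exact ⟨_, X', .res (α := .tau) (.closeR t (.repInp 0 B)),
      withServer_bout_struct (.refl _) s, r⟩

/-- All active calls are performed first. Once none is left, inlining adds no transitions, and the
move of the right side is available on the left. -/
theorem ServerInlined.back {n : ℕ} {X Y Y' : PiProc} {α : Act} (h : ServerInlined n X Y)
    (t : Trans Y α Y') :
    ∃ X₁ X' m, TauMany X X₁ ∧ Trans X₁ α X' ∧ UpToStruct ServerInlined m X' Y' := by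
  induction n generalizing X with
  | zero =>
    obtain ⟨B, P, P', hB, h, rfl, rfl⟩ := h
    rcases t.res_inv with ⟨Z, t₁, rfl⟩ | ⟨a, rfl, t₁⟩
    · obtain ⟨m, Q, t₂, r⟩ := h.back t₁
      exact ⟨_, _, m, .refl, .res (.parL _ t₂), .of (.of_underRes hB r)⟩
    · obtain ⟨m, Q, t₂, -⟩ := h.back t₁
      exact absurd rfl (h.not_out_object t₂ (a + 1))
  | succ n ih =>
    obtain ⟨B, P, P', hB, h, rfl, rfl⟩ := h
    obtain ⟨Z, X, t₁, s, r⟩ := h.exists_tau hB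
    obtain ⟨X₁, X', m, t₂, t₃, u⟩ := ih ⟨B, X, P', hB, r, rfl, rfl⟩
    obtain ⟨X₂, t₄, s₂⟩ := t₂.exists_of_struct s.symm
    obtain ⟨X₃, t₅, s₃⟩ := s₂.exists_trans t₃
    exact ⟨X₂, X₃, m, .head t₁ t₄, t₅, u.of_struct s₃.symm (.refl _)⟩

/-- A private server can be inlined. -/
theorem Inlined.expands {n : ℕ} {B P P' : PiProc} (h : Inlined 0 B n P P') (hB : 1 ∉ B.fn) :
    Expands (withServer P B) (.res P') :=
  ⟨UpToStruct ServerInlined, n, IsExpansion.upToStruct (fun σ h => ServerInlined.rename h σ)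
    (fun h t => ServerInlined.forth h t) (fun h t => ServerInlined.back h t),
    .of ⟨B, P, P', hB, h, rfl, rfl⟩⟩

theorem notMem_fn_rename_upSucc (B : PiProc) : 1 ∉ (B.rename (upName Nat.succ)).fn := by
  rw [mem_fn_rename]
  rintro ⟨_ | m, hm, e⟩ <;> simp at e

/-- A private server that is not used can be dropped. -/
theorem ExpandsMany.withServer_unused (P B : PiProc) :
    ExpandsMany (withServer P.shift (B.rename (upName Nat.succ))) P := by
  refine .trans (.single ((Inlined.refl_of_notMem _ ?_).expands (notMem_fn_rename_upSucc B)))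
    (.of_struct (.resShift P))
  rw [PiProc.shift, mem_fn_rename]
  rintro ⟨m, -, e⟩
  exact Nat.succ_ne_zero m e

/-! ### Renaming and substitution in translations -/

/-- Where the variables of the body of an abstraction are found below the binders `x = 1, c = 0`. -/
def lamNames (ρ : ℕ → ℕ) : ℕ → ℕ
  | 0 => 1
  | n + 1 => ρ n + 2

/-- What the server of a value `v` does when it is called with the name `w`. -/
def serverBody (w : ℕ) (ρ : ℕ → ℕ) : LTerm → PiProc
  | .var x => .out (ρ x) w .nil
  | .lam t => .inp w (.inp (w + 1) (milnerAux (lamNames ρ) t 0))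
  | .app _ _ => .nil

/-- The server `⟦y := v⟧` of a value `v`. -/
def server (y : ℕ) (ρ : ℕ → ℕ) (v : LTerm) : PiProc :=
  .rep (.inp y (serverBody 0 (fun x => ρ x + 1) v))

theorem lamNames_add_two (ρ : ℕ → ℕ) : lamNames (fun x => ρ x + 2) = bodyNames ρ := by
  funext n; cases n <;> rfl

theorem milnerAux_value {v : LTerm} (hv : v.IsValue) (ρ : ℕ → ℕ) (c : ℕ) :
    milnerAux ρ v c = ret c (server 0 (fun x => ρ x + 1) v) := by
  cases hv with
  | var x => rfl
  | lam t =>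
    rw [milnerAux, ← lamNames_add_two]
    rfl

/-- The environment `ρ` makes renaming uniform: a renaming of the process composes with `ρ` on one
side, a renaming of the term (`milnerAux_lrename`) on the other. -/
theorem milnerAux_rename (ρ : ℕ → ℕ) (t : LTerm) (c : ℕ) (σ : ℕ → ℕ) :
    (milnerAux ρ t c).rename σ = milnerAux (fun x => σ (ρ x)) t (σ c) := by
  induction t generalizing ρ c σ with
  | var x => rfl
  | lam t ih =>
    simp only [milnerAux, ret, assignLam, PiProc.rename, ih]
    congr 7
    funext n; cases n <;> rfl
  | app s t ihs iht =>
    simp only [milnerAux, ap, PiProc.rename, ihs, iht]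
    rfl

theorem milnerAux_lrename (ρ τ : ℕ → ℕ) (t : LTerm) (c : ℕ) :
    milnerAux ρ (t.rename τ) c = milnerAux (fun x => ρ (τ x)) t c := by
  induction t generalizing ρ τ c with
  | var x => rfl
  | lam t ih =>
    simp only [milnerAux, LTerm.rename, ih]
    congr 3
    funext n; cases n <;> rfl
  | app s t ihs iht => simp only [milnerAux, LTerm.rename, ihs, iht]

theorem serverBody_rename (w : ℕ) (ρ : ℕ → ℕ) (v : LTerm) (σ : ℕ → ℕ) :
    (serverBody w ρ v).rename σ = serverBody (σ w) (fun x => σ (ρ x)) v := by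
  cases v with
  | var x => rfl
  | lam t =>
    simp only [serverBody, PiProc.rename, milnerAux_rename]
    congr 3
    funext n; cases n <;> rfl
  | app s t => rfl

theorem serverBody_lrename (w : ℕ) (ρ τ : ℕ → ℕ) (v : LTerm) :
    serverBody w ρ (v.rename τ) = serverBody w (fun x => ρ (τ x)) v := by
  cases v with
  | var x => rfl
  | lam t =>
    simp only [serverBody, LTerm.rename, milnerAux_lrename]
    congr 3
    funext n; cases n <;> rfl
  | app s t => rfl

theorem server_rename (y : ℕ) (ρ : ℕ → ℕ) (v : LTerm) (σ : ℕ → ℕ) :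
    (server y ρ v).rename σ = server (σ y) (fun x => σ (ρ x)) v := by
  simp only [server, PiProc.rename, serverBody_rename]
  rfl

theorem LTerm.IsValue.rename {v : LTerm} (hv : v.IsValue) (σ : ℕ → ℕ) : (v.rename σ).IsValue := by
  cases hv with
  | var x => exact .var _
  | lam t => exact .lam _

/-- The server named `k` with body `B` provides the values that `θ` substitutes for the variables
found at `k`; the other variables are only renamed. -/
structure Provides (k : ℕ) (B : PiProc) (ρ : ℕ → ℕ) (θ : ℕ → LTerm) (ρ' : ℕ → ℕ) : Prop where
  ne : ∀ y, ρ' y ≠ k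
  subst : ∀ x, (∃ y, θ x = .var y ∧ ρ x = ρ' y) ∨
    (ρ x = k ∧ (θ x).IsValue ∧ B = serverBody 0 (fun y => ρ' y + 1) (θ x))

theorem Provides.shift {k : ℕ} {B : PiProc} {ρ ρ' : ℕ → ℕ} {θ : ℕ → LTerm}
    (h : Provides k B ρ θ ρ') :
    Provides (k + 1) (B.rename (upName Nat.succ)) (fun x => ρ x + 1) θ (fun x => ρ' x + 1) := by
  refine ⟨fun y => by simpa using h.ne y, fun x => ?_⟩
  rcases h.subst x with ⟨y, e₁, e₂⟩ | ⟨e, hv, rfl⟩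
  · exact .inl ⟨y, e₁, by rw [e₂]⟩
  · exact .inr ⟨by rw [e], hv, serverBody_rename _ _ _ _⟩

/-- Passage below an abstraction: the new variable sits at `a ≠ k` and stays a variable, while
weakening a provided value is compensated by the extended environment. -/
theorem Provides.lam {k : ℕ} {B : PiProc} {ρ ρ' : ℕ → ℕ} {θ : ℕ → LTerm}
    (h : Provides k B ρ θ ρ') {a : ℕ} (ha : a ≠ k) {ρ₁ ρ₁' : ℕ → ℕ}
    (h₀ : ρ₁ 0 = a) (h₁ : ∀ n, ρ₁ (n + 1) = ρ n) (h₀' : ρ₁' 0 = a) (h₁' : ∀ n, ρ₁' (n + 1) = ρ' n) :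
    Provides k B ρ₁ (LTerm.upSubst θ) ρ₁' := by
  constructor
  · rintro (_ | y)
    · rwa [h₀']
    · rw [h₁']; exact h.ne y
  · rintro (_ | x)
    · exact .inl ⟨0, rfl, by rw [h₀, h₀']⟩
    · rw [h₁, LTerm.upSubst]
      rcases h.subst x with ⟨y, e₁, e₂⟩ | ⟨e, hv, rfl⟩
      · exact .inl ⟨y + 1, by rw [e₁]; rfl, by rw [e₂, h₁']⟩
      · refine .inr ⟨e, hv.rename _, ?_⟩
        rw [serverBody_lrename]
        simp only [Nat.succ_eq_add_one, h₁']

/-- Inlining the server of a value in a translation is the translation of the substitution. -/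
theorem Provides.inlined {k c : ℕ} {B : PiProc} {ρ ρ' : ℕ → ℕ} {θ : ℕ → LTerm}
    (h : Provides k B ρ θ ρ') (hc : c ≠ k) (t : LTerm) :
    ∃ n, Inlined k B n (milnerAux ρ t c) (milnerAux ρ' (t.subst θ) c) := by
  induction t generalizing k c B ρ ρ' θ with
  | var x =>
    rcases h.subst x with ⟨y, e₁, e₂⟩ | ⟨e, hv, e'⟩
    · have hy := h.ne y
      refine ⟨0, ?_⟩
      rw [LTerm.subst, e₁, milnerAux, milnerAux, e₂]
      exact .res (.out (by simpa using hc) (by simp)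
        (.rep (.inp (by simp) (.out (by simpa using hy) (by simp) .nil))))
    -- The forwarder of this variable calls the server, and inlining that call gives the server of
    -- the value itself. The call is guarded by the input, so the grade is `0`.
    · refine ⟨0, ?_⟩
      rw [LTerm.subst, milnerAux_value hv, milnerAux, e]
      refine .res (.out (by simpa using hc) (by simp) (.rep (.inp (by simp)
        ((Inlined.call (b := 0) (by simp)).congr rfl rfl rfl rfl ?_))))
      rw [upSucc_inst_zero, e', serverBody_rename]
      rfl
  | lam t ih =>
    -- The four shifts are for the binders of `y`, `w`, `x` and `c`; the bound variable `x` has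
    -- index `1`.
    have h' := h.shift.shift.shift.shift.lam (a := 1) (by simp) (ρ₁ := bodyNames ρ)
      (ρ₁' := bodyNames ρ') rfl (fun _ => rfl) rfl (fun _ => rfl)
    obtain ⟨n, i⟩ := ih h' (c := 0) (by simp)
    exact ⟨0, .res (.out (by simpa using hc) (by simp)
      (.rep (.inp (by simp) (.inp (by simp) (.inp (by simp) i)))))⟩
  | app s t ihs iht =>
    obtain ⟨n, is⟩ := ihs h.shift.shift (c := 1) (by simp)
    obtain ⟨m, it⟩ := iht h.shift.shift (c := 0) (by simp)
    refine ⟨0 + n + m, .res (.res (.par (.par ?_ is) it))⟩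
    exact .inp (by simp) (.res (.out (by simp) (by simp) (.inp (by simp)
      (.out (by simp) (by simp) (.out (by simp) (by simpa using hc) .nil)))))

/-- The process side of a β-reduction. After inlining, the name of the server is unused and its
restriction disappears. -/
theorem milnerAux_inlined {u : LTerm} (hu : u.IsValue) (ρ : ℕ → ℕ) (t : LTerm) (c : ℕ) :
    ExpandsMany
      (withServer (milnerAux (fun | 0 => 0 | n + 1 => ρ n + 1) t (c + 1))
        (serverBody 0 (fun x => ρ x + 2) u))
      (milnerAux ρ (t.subst (LTerm.instSubst u)) c) := by
  have h : Provides 0 (serverBody 0 (fun x => ρ x + 2) u) (fun | 0 => 0 | n + 1 => ρ n + 1)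
      (LTerm.instSubst u) (fun x => ρ x + 1) := by
    refine ⟨fun y => by simp, ?_⟩
    rintro (_ | x)
    · exact .inr ⟨rfl, hu, rfl⟩
    · exact .inl ⟨x, rfl, rfl⟩
  obtain ⟨n, i⟩ := h.inlined (c := c + 1) (by simp) t
  refine .trans (.single (i.expands ?_)) (.of_struct ?_)
  · have : serverBody 0 (fun x => ρ x + 2) u =
        (serverBody 0 (fun x => ρ x + 1) u).rename (upName Nat.succ) :=
      (serverBody_rename 0 (fun x => ρ x + 1) u (upName Nat.succ)).symm
    rw [this]
    exact notMem_fn_rename_upSucc _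
  · have := Struct.resShift (milnerAux ρ (t.subst (LTerm.instSubst u)) c)
    rwa [PiProc.shift, milnerAux_rename] at this

/-! ### Configurations: terms with partially evaluated applications -/

/-- `app M N` waits for the function, `called v N` has called the function `v` and waits for the
argument, and `stuck x u` has called the variable `x` with the argument `u`. -/
inductive Conf : Type
  | val (v : LTerm) (hv : v.IsValue)
  | app (M N : Conf)
  | called (v : LTerm) (hv : v.IsValue) (N : Conf)
  | stuck (x : ℕ) (u : LTerm) (hu : u.IsValue)

namespace Conf

/-- The term that a configuration represents. -/
def toTerm : Conf → LTerm
  | val v _ => v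
  | app M N => .app M.toTerm N.toTerm
  | called v _ N => .app v N.toTerm
  | stuck x u _ => .app (.var x) u

/-- The initial configuration of a term. -/
def ofTerm : LTerm → Conf
  | .var x => val (.var x) (.var x)
  | .lam t => val (.lam t) (.lam t)
  | .app s t => app (ofTerm s) (ofTerm t)

/-- The process of a configuration. -/
def proc : (ℕ → ℕ) → Conf → ℕ → PiProc
  | ρ, val v _, c => ret c (server 0 (fun x => ρ x + 1) v)
  | ρ, app M N, c =>
      .res (.res (.par (.par (ap (c + 2) 1 0) (proc (fun x => ρ x + 2) M 1))
        (proc (fun x => ρ x + 2) N 0)))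
  | ρ, called v _ N, c =>
      .res (.par
        (.res (.par (.inp 1 (.out 1 0 (.out 1 (c + 3) .nil))) (serverBody 0 (fun x => ρ x + 2) v)))
        (proc (fun x => ρ x + 1) N 0))
  | ρ, stuck x u _, c =>
      .res (.par (.res (.par (.out 0 1 (.out 0 (c + 2) .nil)) (.out (ρ x + 2) 0 .nil)))
        (server 0 (fun x => ρ x + 1) u))

/-- The steps of configurations. -/
inductive Step : Conf → Conf → Prop
  | appL {M M' N : Conf} : Step M M' → Step (app M N) (app M' N)
  | appR {M N N' : Conf} : Step N N' → Step (app M N) (app M N')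
  | calledR {v : LTerm} {hv : v.IsValue} {N N' : Conf} :
      Step N N' → Step (called v hv N) (called v hv N')
  | call {v : LTerm} {hv : v.IsValue} {N : Conf} : Step (app (val v hv) N) (called v hv N)
  | beta {t u : LTerm} {ht : (LTerm.lam t).IsValue} {hu : u.IsValue} :
      Step (called (.lam t) ht (val u hu)) (ofTerm (t.subst (LTerm.instSubst u)))
  | stuck {x : ℕ} {u : LTerm} {hx : (LTerm.var x).IsValue} {hu : u.IsValue} :
      Step (called (.var x) hx (val u hu)) (stuck x u hu)

/-- The number of steps before the next β-reductions. -/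
def size : Conf → ℕ
  | val _ _ => 0
  | app M N => M.size + N.size + 2
  | called _ _ N => N.size + 1
  | stuck _ _ _ => 0

theorem toTerm_ofTerm (t : LTerm) : (ofTerm t).toTerm = t := by
  induction t with
  | var x => rfl
  | lam t => rfl
  | app s t ihs iht => rw [ofTerm, toTerm, ihs, iht]

theorem ofTerm_value {v : LTerm} (hv : v.IsValue) : ofTerm v = val v hv := by
  cases hv <;> rfl

theorem proc_ofTerm (ρ : ℕ → ℕ) (t : LTerm) (c : ℕ) : proc ρ (ofTerm t) c = milnerAux ρ t c := by
  induction t generalizing ρ c with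
  | var x => rw [milnerAux_value (.var x)]; rfl
  | lam t => rw [milnerAux_value (.lam t)]; rfl
  | app s t ihs iht => rw [ofTerm, proc, ihs, iht, milnerAux]

theorem proc_rename (ρ : ℕ → ℕ) (Q : Conf) (c : ℕ) (σ : ℕ → ℕ) :
    (proc ρ Q c).rename σ = proc (fun x => σ (ρ x)) Q (σ c) := by
  induction Q generalizing ρ c σ with
  | val v _ => simp only [proc, ret, PiProc.rename, server_rename]; rfl
  | app M N ihM ihN => simp only [proc, ap, PiProc.rename, ihM, ihN]; rfl
  | called v _ N ihN => simp only [proc, PiProc.rename, ihN, serverBody_rename]; rfl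
  | stuck x u _ => simp only [proc, PiProc.rename, server_rename]; rfl

/-- Only `beta` changes the represented term, and it may increase the size; the administrative steps
lower the size. This is the measure behind divergence reflection. -/
theorem Step.toTerm {Q Q' : Conf} (h : Step Q Q') :
    (Q'.toTerm = Q.toTerm ∧ Q'.size < Q.size) ∨ LTerm.Red Q.toTerm Q'.toTerm := by
  induction h with
  | appL _ ih =>
    rcases ih with ⟨e, h⟩ | h
    · exact .inl ⟨by simp only [Conf.toTerm, e], by simp only [size]; omega⟩
    · exact .inr (.appL h)
  | appR _ ih =>
    rcases ih with ⟨e, h⟩ | h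
    · exact .inl ⟨by simp only [Conf.toTerm, e], by simp only [size]; omega⟩
    · exact .inr (.appR h)
  | calledR _ ih =>
    rcases ih with ⟨e, h⟩ | h
    · exact .inl ⟨by simp only [Conf.toTerm, e], by simp only [size]; omega⟩
    · exact .inr (.appR h)
  | call => exact .inl ⟨rfl, by simp only [size]; omega⟩
  | @beta _ _ _ hu => exact .inr (by rw [toTerm_ofTerm]; exact .beta hu)
  | stuck => exact .inl ⟨rfl, by simp only [size]; omega⟩

theorem steps_of_red {s s' : LTerm} (h : LTerm.Red s s') :
    Relation.ReflTransGen Step (ofTerm s) (ofTerm s') := by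
  induction h with
  | @beta t v hv =>
    rw [ofTerm, ofTerm_value hv]
    exact .head .call (.single .beta)
  | appL _ ih => exact ih.lift (fun M => app M _) fun _ _ h => .appL h
  | appR _ ih => exact ih.lift (fun N => app _ N) fun _ _ h => .appR h

/-! ### The communications of an application -/

/-- The process `Q` does not use the outer restricted name, so the restrictions are exchanged and
that name is confined to `P`, where a communication law for private channels applies. -/
theorem _root_.LambdaPi.PiProc.Struct.resOut (P Q : PiProc) :
    Struct (.res (.res (.par P (Q.rename (upName Nat.succ)))))
      (.res (.par (.res (P.rename swapName)) Q)) := by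
  refine .trans (.resSwap _) (.congRes ?_)
  rw [PiProc.rename, rename_upSucc_swap]
  exact (Struct.extrudeL _ _).symm

/-- A linear communication of a private name, next to a bystander. -/
theorem _root_.LambdaPi.ExpandsMany.linear_bout (A S N : PiProc) :
    ExpandsMany
      (.res (.res (.par (.par (.inp 1 A) (.res (.out 2 0 S))) (N.rename (upName Nat.succ)))))
      (.res (.res (.par (.res (.par A S)) (N.rename (upName Nat.succ))))) := by
  refine .trans (.of_struct (.resOut _ _)) (.trans (.res (.par (.single (.linear_bout _ _)) _)) ?_)
  exact .of_struct (Struct.resOut (.res (.par A S)) N).symm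

/-- The process of `app (val v) N` after the communication of the function. -/
def applied (ρ : ℕ → ℕ) (v : LTerm) (N : Conf) (c : ℕ) : PiProc :=
  .res (.res (.par
    (.res (.par (.res (.out 1 0 (.inp 2 (.out 1 0 (.out 1 (c + 5) .nil)))))
      (server 0 (fun x => ρ x + 3) v)))
    (proc (fun x => ρ x + 2) N 0)))

theorem app_expandsMany_applied (ρ : ℕ → ℕ) (v : LTerm) (hv : v.IsValue) (N : Conf) (c : ℕ) :
    ExpandsMany (proc ρ (app (val v hv) N) c) (applied ρ v N c) := by
  have := ExpandsMany.linear_bout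
    (.res (.out 1 0 (.inp 2 (.out 1 0 (.out 1 (c + 5) .nil)))))
    (server 0 (fun x => ρ x + 3) v) (proc (fun x => ρ x + 1) N 0)
  rwa [proc_rename] at this

theorem applied_expandsMany (ρ : ℕ → ℕ) (v : LTerm) (hv : v.IsValue) (N : Conf) (c : ℕ) :
    ExpandsMany (applied ρ v N c) (proc ρ (called v hv N) c) := by
  let L : PiProc := .res (.par (.inp 1 (.out 1 0 (.out 1 (c + 4) .nil)))
    (serverBody 0 (fun x => ρ x + 3) v))
  have h₁ : ExpandsMany
      (.res (.par (.res (.out 1 0 (.inp 2 (.out 1 0 (.out 1 (c + 5) .nil)))))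
        (server 0 (fun x => ρ x + 3) v))) L := by
    refine .trans (.single (.server_call _ _)) ?_
    refine .trans (.of_struct (.congRes (.trans (.congRes (.parAssoc _ _ _))
      (Struct.extrudeL _ _).symm))) ?_
    -- The call was the only use of the function's server, so the remaining replicated copy is
    -- garbage.
    have := ExpandsMany.withServer_unused L (serverBody 0 (fun x => ρ x + 3) v)
    simp only [L, withServer, PiProc.shift, PiProc.rename, serverBody_rename] at this
    exact this
  refine (h₁.par _).res.res.trans (.of_struct ?_)
  have := Struct.resShift (proc ρ (called v hv N) c)
  rwa [PiProc.shift, proc_rename] at this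

/-- The process of `called v (val u)` after the communication of the argument. -/
def supplied (ρ : ℕ → ℕ) (v u : LTerm) (c : ℕ) : PiProc :=
  .res (.res (.par
    (.res (.par (.out 0 1 (.out 0 (c + 3) .nil)) (serverBody 0 (fun x => ρ x + 3) v)))
    (server 0 (fun x => ρ x + 2) u)))

/-- The receiver of the argument lies below the restriction of the call channel. That restriction is
extruded to expose the linear communication, and its scope is narrowed again afterwards. -/
theorem called_expandsMany_supplied (ρ : ℕ → ℕ) (v u : LTerm) (hv : v.IsValue) (hu : u.IsValue)
    (c : ℕ) : ExpandsMany (proc ρ (called v hv (val u hu)) c) (supplied ρ v u c) := by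
  have h := ExpandsMany.linear_bout (.out 1 0 (.out 1 (c + 3) .nil))
    (server 0 (fun x => ρ x + 3) u) (serverBody 0 (fun x => ρ x + 1) v)
  rw [serverBody_rename] at h
  refine .trans (.of_struct (.congRes ?_)) (h.trans (.of_struct (.congRes ?_)))
  · refine .trans (.extrudeL _ _) (.congRes (.trans ?_ (.parRightComm _ _ _)))
    rw [PiProc.shift, proc_rename]
    exact .refl _
  · have e : server 0 (fun x => ρ x + 3) u =
        (server 0 (fun x => ρ x + 2) u).rename (upName Nat.succ) :=
      (server_rename 0 (fun x => ρ x + 2) u (upName Nat.succ)).symm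
    rw [e]
    refine .trans (.congRes (.trans (.extrudeL _ _) (.congRes (.parRightComm _ _ _))))
      (.trans (.resOut _ _) ?_)
    simp only [PiProc.rename, PiProc.shift, serverBody_rename]
    exact .refl _

theorem supplied_var_struct (ρ : ℕ → ℕ) (x : ℕ) (u : LTerm) (hu : u.IsValue) (c : ℕ) :
    (supplied ρ (.var x) u c).Struct (proc ρ (stuck x u hu) c) := by
  have := Struct.resShift (proc ρ (stuck x u hu) c)
  rwa [PiProc.shift, proc_rename] at this

theorem supplied_lam_expandsMany (ρ : ℕ → ℕ) (t u : LTerm) (hu : u.IsValue) (c : ℕ) :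
    ExpandsMany (supplied ρ (.lam t) u c) (milnerAux ρ (t.subst (LTerm.instSubst u)) c) := by
  have h₁ : ExpandsMany
      (.res (.par (.out 0 1 (.out 0 (c + 3) .nil)) (serverBody 0 (fun x => ρ x + 3) (.lam t))))
      (milnerAux (fun | 0 => 0 | n + 1 => ρ n + 2) t (c + 2)) := by
    -- The two linear communications hand over the name of the argument's server and then the return
    -- channel.
    refine .trans (.single (.linear_out _ _ _)) (.trans (.single (.linear_out _ _ _)) ?_)
    refine .trans (.of_struct (.congRes (.nilPar _))) (.of_struct ?_)
    have := Struct.resShift (milnerAux (fun | 0 => 0 | n + 1 => ρ n + 2) t (c + 2))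
    simp only [PiProc.shift, PiProc.inst, milnerAux_rename] at this ⊢
    convert this using 3
    · funext n; cases n <;> rfl
    · rfl
  have h₂ := milnerAux_inlined hu (fun x => ρ x + 1) t (c + 1)
  refine (h₁.par _).res.res.trans (h₂.res.trans (.of_struct ?_))
  have := Struct.resShift (milnerAux ρ (t.subst (LTerm.instSubst u)) c)
  rwa [PiProc.shift, milnerAux_rename] at this

/-! ### Transitions of configurations -/

theorem serverBody_trans {w : ℕ} {ρ : ℕ → ℕ} {v : LTerm} {α : Act} {X : PiProc}
    (t : Trans (serverBody w ρ v) α X) : α = .inp w ∨ ∃ x, α = .out (ρ x) w := by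
  cases v with
  | var x => exact .inr ⟨x, t.out_inv.1⟩
  | lam s => exact .inl t.inp_inv.1
  | app s t => cases t

theorem server_trans {y : ℕ} {ρ : ℕ → ℕ} {v : LTerm} {α : Act} {X : PiProc}
    (t : Trans (server y ρ v) α X) : α = .inp y := t.repInp_inv.1

/-- The two components cannot interact: the outputs on the private call channel are still guarded by
the input of the argument. What remains is that input, or the call of a free variable. -/
theorem head_trans {ρ : ℕ → ℕ} {v : LTerm} {c : ℕ} {α : Act} {X : PiProc}
    (t₀ : Trans (.res (.par (.inp 1 (.out 1 0 (.out 1 c .nil)))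
      (serverBody 0 (fun x => ρ x + 2) v))) α X) :
    (α = .inp 0 ∧ X = .res (.par (.out 0 1 (.out 0 (swapName c) .nil))
      ((serverBody 0 (fun x => ρ x + 2) v).rename (upName Nat.succ)))) ∨
    ∃ x, α = .bout (ρ x + 1) := by
  rcases t₀.res_inv with ⟨Z, t, rfl⟩ | ⟨a', rfl, t₁⟩
  · generalize e : α.shift = β at t
    cases t with
    | parL _ t₂ =>
      obtain ⟨rfl, rfl⟩ := t₂.inp_inv
      cases α <;> cases e
      refine .inl ⟨rfl, ?_⟩
      simp only [Act.underRes, Act.bystander, PiProc.rename, shift_swap]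
      rfl
    | parR _ t₂ =>
      subst e
      rcases serverBody_trans t₂ with e | ⟨x, e⟩
      · exact absurd e α.shift_ne_inp_zero
      · cases α <;> cases e
    | commL t₁ t₂ =>
      cases t₁
      rcases serverBody_trans t₂ with e | ⟨x, e⟩ <;> cases e
    | commR t₁ _ => cases t₁
    | closeL _ t₂ => rcases serverBody_trans t₂ with e | ⟨x, e⟩ <;> cases e
    | closeR t₁ _ => cases t₁
  · cases t₁ with
    | parL _ t => cases t
    | parR _ t =>
      rcases serverBody_trans t with e | ⟨x, e⟩ <;> cases e
      exact .inr ⟨x, rfl⟩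

theorem stuckHead_trans {a b c : ℕ} {α : Act} {X : PiProc}
    (t₀ : Trans (.res (.par (.out 0 b (.out 0 c .nil)) (.out (a + 1) 0 .nil))) α X) :
    α = .bout a := by
  rcases t₀.res_inv with ⟨Z, t, rfl⟩ | ⟨a', rfl, t₁⟩
  · generalize e : α.shift = β at t
    cases t with
    | parL _ t₂ => exact absurd (e.trans t₂.out_inv.1) (α.shift_ne_out_zero _)
    | parR _ t₂ =>
      have := e.trans t₂.out_inv.1
      cases α <;> cases this
    | commL t₁ _ => cases t₁
    | commR _ t₂ => cases t₂
    | closeL t₁ _ => cases t₁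
    | closeR _ t₂ => cases t₂
  · cases t₁ with
    | parL _ t => cases t
    | parR _ t => cases t; rfl

/-- The visible transitions of a configuration: a value is returned, or a free variable is
called. -/
theorem proc_trans {ρ : ℕ → ℕ} {Q : Conf} {c : ℕ} {α : Act} {X : PiProc}
    (t₀ : Trans (proc ρ Q c) α X) :
    α = .tau ∨ (∃ v hv, α = .bout c ∧ Q = val v hv ∧ X = server 0 (fun x => ρ x + 1) v) ∨
      ∃ x, α = .bout (ρ x) := by
  by_cases hα : α = .tau
  · exact .inl hα
  refine .inr ?_
  induction Q generalizing ρ c α X with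
  | val v hv =>
    obtain ⟨rfl, rfl⟩ := Trans.resOut_inv t₀
    exact .inl ⟨v, hv, rfl, rfl, rfl⟩
  | app M N ihM ihN =>
    right
    have key : ∀ β Y, Trans (.par (.par (ap (c + 2) 1 0) (proc (fun x => ρ x + 2) M 1))
        (proc (fun x => ρ x + 2) N 0)) β Y → β ≠ .tau →
        β = .inp 1 ∨ β = .bout 0 ∨ β = .bout 1 ∨ ∃ x, β = .bout (ρ x + 2) := by
      intro β Y t hβ
      cases t with
      | parL _ t =>
        cases t with
        | parL _ t => exact .inl t.inp_inv.1
        | parR _ t =>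
          rcases ihM t hβ with ⟨v, hv, e, -⟩ | h
          · exact .inr (.inr (.inl e))
          · exact .inr (.inr (.inr h))
        | _ => exact absurd rfl hβ
      | parR _ t =>
        rcases ihN t hβ with ⟨v, hv, e, -⟩ | h
        · exact .inr (.inl e)
        · exact .inr (.inr (.inr h))
      | _ => exact absurd rfl hβ
    rcases t₀.res_inv with ⟨Z, t₁, rfl⟩ | ⟨a, rfl, t₁⟩
    · rcases t₁.res_inv with ⟨Z, t, rfl⟩ | ⟨a, e, t⟩
      · rcases key _ _ t (fun e => hα (Act.shift_eq_tau (Act.shift_eq_tau e))) with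
          e | e | e | ⟨x, e⟩ <;> cases α <;> cases e
        exact ⟨x, rfl⟩
      · rcases key _ _ t (by simp) with e | e | e | ⟨x, e⟩ <;> cases e
    · rcases t₁.res_inv with ⟨Z, t, rfl⟩ | ⟨a, e, t⟩
      · rcases key _ _ t (by simp [Act.shift]) with e | e | e | ⟨x, e⟩ <;> cases e
      · cases e
  | called v hv N ihN =>
    right
    have key : ∀ β Y, Trans (.par
        (.res (.par (.inp 1 (.out 1 0 (.out 1 (c + 3) .nil)))
          (serverBody 0 (fun x => ρ x + 2) v)))
        (proc (fun x => ρ x + 1) N 0)) β Y → β ≠ .tau →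
        β = .inp 0 ∨ β = .bout 0 ∨ ∃ x, β = .bout (ρ x + 1) := by
      intro β Y t hβ
      cases t with
      | parL _ t =>
        rcases head_trans t with ⟨e, -⟩ | h
        · exact .inl e
        · exact .inr (.inr h)
      | parR _ t =>
        rcases ihN t hβ with ⟨v, hv, e, -⟩ | h
        · exact .inr (.inl e)
        · exact .inr (.inr h)
      | _ => exact absurd rfl hβ
    rcases t₀.res_inv with ⟨Z, t, rfl⟩ | ⟨a, rfl, t⟩
    · rcases key _ _ t (fun e => hα (Act.shift_eq_tau e)) with e | e | ⟨x, e⟩ <;>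
        cases α <;> cases e
      exact ⟨x, rfl⟩
    · rcases key _ _ t (by simp) with e | e | ⟨x, e⟩ <;> cases e
  | stuck x u hu =>
    right
    have key : ∀ β Y, Trans (.par
        (.res (.par (.out 0 1 (.out 0 (c + 2) .nil)) (.out (ρ x + 2) 0 .nil)))
        (server 0 (fun x => ρ x + 1) u)) β Y → β ≠ .tau →
        β = .inp 0 ∨ β = .bout (ρ x + 1) := by
      intro β Y t hβ
      cases t with
      | parL _ t => exact .inr (stuckHead_trans t)
      | parR _ t => exact .inl (server_trans t)
      | _ => exact absurd rfl hβ
    rcases t₀.res_inv with ⟨Z, t, rfl⟩ | ⟨a, rfl, t⟩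
    · rcases key _ _ t (fun e => hα (Act.shift_eq_tau e)) with e | e <;>
        cases α <;> cases e
      exact ⟨x, rfl⟩
    · rcases key _ _ t (by simp) with e | e <;> cases e

theorem proc_not_inp {ρ : ℕ → ℕ} {Q : Conf} {c a : ℕ} {X : PiProc}
    (t : Trans (proc ρ Q c) (.inp a) X) : False := by
  rcases proc_trans t with e | ⟨v, hv, e, -⟩ | ⟨x, e⟩ <;> cases e

theorem proc_not_out {ρ : ℕ → ℕ} {Q : Conf} {c a b : ℕ} {X : PiProc}
    (t : Trans (proc ρ Q c) (.out a b) X) : False := by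
  rcases proc_trans t with e | ⟨v, hv, e, -⟩ | ⟨x, e⟩ <;> cases e

theorem proc_bout {ρ : ℕ → ℕ} {Q : Conf} {c : ℕ} {X : PiProc}
    (t : Trans (proc ρ Q c) (.bout c) X) (h : ∀ x, ρ x ≠ c) :
    ∃ v hv, Q = val v hv ∧ X = server 0 (fun x => ρ x + 1) v := by
  rcases proc_trans t with e | ⟨v, hv, e, h'⟩ | ⟨x, e⟩
  · cases e
  · exact ⟨v, hv, h'⟩
  · cases e; exact absurd rfl (h x)

/-- Every internal transition of a configuration belongs to a step. -/
theorem exists_step {ρ : ℕ → ℕ} {Q : Conf} {c : ℕ} {X : PiProc}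
    (t₀ : Trans (proc ρ Q c) .tau X) :
    ∃ Q', Step Q Q' ∧ ExpandsMany X (proc ρ Q' c) := by
  induction Q generalizing ρ c X with
  | val v hv => cases (Trans.resOut_inv t₀).1
  | app M N ihM ihN =>
    rcases t₀.res_inv with ⟨Z, t', rfl⟩ | ⟨a, e, -⟩
    swap
    · cases e
    rcases t'.res_inv with ⟨Z, t, rfl⟩ | ⟨a, e, -⟩
    swap
    · cases e
    change Trans _ .tau Z at t
    change ∃ Q', _ ∧ ExpandsMany (.res (.res Z)) _
    generalize eβ : Act.tau = β at t
    cases t with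
    | parL _ t =>
      cases t with
      | parL _ t => cases eβ.trans t.inp_inv.1
      | parR _ t =>
        subst eβ
        obtain ⟨M', s, h⟩ := ihM t
        exact ⟨_, .appL s, ((h.parR _).par _).res.res⟩
      | commL _ t => exact (proc_not_out t).elim
      | commR t _ => cases t
      | closeL t₁ t₂ =>
        obtain ⟨e, rfl⟩ := t₁.inp_inv
        cases e
        obtain ⟨v, hv, rfl, rfl⟩ := proc_bout t₂ (by simp)
        exact ⟨_, .call, applied_expandsMany ρ v hv N c⟩
      | closeR t _ => cases t
    | parR _ t =>
      subst eβ
      obtain ⟨N', s, h⟩ := ihN t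
      exact ⟨_, .appR s, (h.parR _).res.res⟩
    | commL _ t => exact (proc_not_out t).elim
    | commR _ t => exact (proc_not_inp t).elim
    | closeL t₁ t₂ =>
      cases t₁ with
      | parL _ t₁ =>
        -- The process `ap` listens on the channel of the function first, so the argument cannot
        -- return its value yet.
        cases t₁
        rcases proc_trans t₂ with e | ⟨v, hv, e, -⟩ | ⟨x, e⟩ <;> cases e
      | parR _ t₁ => exact (proc_not_inp t₁).elim
    | closeR _ t => exact (proc_not_inp t).elim
  | called v hv N ihN =>
    rcases t₀.res_inv with ⟨Z, t, rfl⟩ | ⟨a, e, -⟩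
    swap
    · cases e
    change Trans _ .tau Z at t
    change ∃ Q', _ ∧ ExpandsMany (.res Z) _
    generalize eβ : Act.tau = β at t
    cases t with
    | parL _ t =>
      subst eβ
      rcases head_trans t with ⟨e, -⟩ | ⟨x, e⟩ <;> cases e
    | parR _ t =>
      subst eβ
      obtain ⟨N', s, h⟩ := ihN t
      exact ⟨_, .calledR s, (h.parR _).res⟩
    | commL _ t => exact (proc_not_out t).elim
    | commR _ t => exact (proc_not_inp t).elim
    | closeL t₁ t₂ =>
      rcases head_trans t₁ with ⟨e, rfl⟩ | ⟨x, e⟩ <;> cases e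
      obtain ⟨u, hu, rfl, rfl⟩ := proc_bout t₂ (by simp)
      rw [serverBody_rename]
      cases hv with
      | var x => exact ⟨_, .stuck (hu := hu), .of_struct (supplied_var_struct ρ x u hu c)⟩
      | lam s =>
        refine ⟨_, .beta (hu := hu), ?_⟩
        rw [proc_ofTerm]
        exact supplied_lam_expandsMany ρ s u hu c
    | closeR _ t => exact (proc_not_inp t).elim
  | stuck x u hu =>
    rcases t₀.res_inv with ⟨Z, t, rfl⟩ | ⟨a, e, -⟩
    swap
    · cases e
    change Trans _ .tau Z at t
    generalize eβ : Act.tau = β at t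
    cases t with
    | parL _ t => cases eβ.trans (stuckHead_trans t)
    | parR _ t => cases eβ.trans (server_trans t)
    | commL _ t => cases server_trans t
    | commR t _ => cases stuckHead_trans t
    | closeL _ t => cases server_trans t
    | closeR t₁ t₂ =>
      have e₁ := stuckHead_trans t₁
      have e₂ := server_trans t₂
      cases e₂; cases e₁

/-- Each communication involved is either linear on a private channel or a call of a private server,
hence inert, and expansion is preserved by the surrounding evaluation context. -/
theorem Step.expandsMany {Q Q' : Conf} (h : Step Q Q') (ρ : ℕ → ℕ) (c : ℕ) :
    ExpandsMany (proc ρ Q c) (proc ρ Q' c) := by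
  induction h generalizing ρ c with
  | appL _ ih => exact (((ih _ _).parR _).par _).res.res
  | appR _ ih => exact ((ih _ _).parR _).res.res
  | calledR _ ih => exact ((ih _ _).parR _).res
  | call => exact (app_expandsMany_applied _ _ _ _ _).trans (applied_expandsMany _ _ _ _ _)
  | @beta t u ht hu =>
    rw [proc_ofTerm]
    exact (called_expandsMany_supplied _ _ _ _ _ _).trans (supplied_lam_expandsMany ρ t u hu c)
  | stuck =>
    exact (called_expandsMany_supplied _ _ _ _ _ _).trans
      (.of_struct (supplied_var_struct _ _ _ _ _))

/-- Internal transitions of a configuration do not change its behaviour. -/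
theorem behEquiv_of_tauSteps {n : ℕ} {ρ : ℕ → ℕ} {Q : Conf} {c : ℕ} {X : PiProc}
    (h : TauSteps n (proc ρ Q c) X) : BehEquiv X (proc ρ Q c) := by
  induction n using Nat.strong_induction_on generalizing Q X with
  | _ n ih =>
    cases h with
    | refl => exact .refl _
    | head t h =>
      obtain ⟨Q', s, e⟩ := exists_step t
      obtain ⟨m, hm, Y, h', e'⟩ := e.exists_tauSteps h
      -- The remaining steps are replayed from `Q'` in no greater number, so the induction
      -- hypothesis applies to `Q'`.
      exact e'.behEquiv.trans ((ih m (by omega) h').trans (s.expandsMany ρ c).behEquiv.symm)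

/-- Lexicographic induction on the reductions of the represented term and then on the size of the
configuration. -/
theorem terminates {Q : Conf} (h : Acc (fun s' s => LTerm.Red s s') Q.toTerm) (ρ : ℕ → ℕ)
    (c : ℕ) : Terminates (proc ρ Q c) := by
  generalize e : Q.toTerm = s at h
  induction h generalizing Q with
  | intro s _ ih =>
    generalize ek : Q.size = k
    induction k using Nat.strong_induction_on generalizing Q with
    | _ k ihk =>
      refine ⟨_, fun X t => ?_⟩
      obtain ⟨Q', st, ex⟩ := exists_step t
      refine ex.terminates ?_
      rcases st.toTerm with ⟨e', hk⟩ | r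
      · exact ihk _ (ek ▸ hk) (e'.trans e) rfl
      · exact ih _ (e ▸ r) rfl

end Conf

/-! ### Reductions and internal transitions -/

theorem TauMany.exists_tauSteps {X Y : PiProc} (h : TauMany X Y) : ∃ n, TauSteps n X Y := by
  induction h using Relation.ReflTransGen.head_induction_on with
  | refl => exact ⟨0, .refl Y⟩
  | head t _ ih =>
    obtain ⟨n, h⟩ := ih
    exact ⟨n + 1, .head t h⟩

theorem exists_tauMany_of_red {X Y : PiProc} (h : Many PiProc.Red X Y) :
    ∃ Z, TauMany X Z ∧ Z.Struct Y := by
  induction h with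
  | refl => exact ⟨X, .refl, .refl X⟩
  | tail _ r ih =>
    obtain ⟨Z, h, s⟩ := ih
    obtain ⟨W, t, s'⟩ := r.exists_trans
    obtain ⟨V, t', s''⟩ := s.symm.exists_trans t
    exact ⟨V, h.tail t', s''.symm.trans s'⟩

theorem Terminates.not_diverges {X : PiProc} (h : Terminates X) : ¬ Diverges PiProc.Red X := by
  suffices H : ∀ f : ℕ → PiProc, (f 0).Struct X → ¬ ∀ n, PiProc.Red (f n) (f (n + 1)) by
    rintro ⟨f, rfl, hf⟩
    exact H f (.refl _) hf
  induction h with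
  | intro X _ ih =>
    intro f s hf
    obtain ⟨W, t, s'⟩ := (hf 0).exists_trans
    obtain ⟨V, t', s''⟩ := s.exists_trans t
    exact ih V t' (fun n => f (n + 1)) (s'.symm.trans s'') fun n => hf (n + 1)

theorem milner_eq_proc (c : ℕ) (t : LTerm) : milner c t = Conf.proc id (Conf.ofTerm t) c :=
  (Conf.proc_ofTerm id t c).symm

theorem Conf.behEquiv_of_steps {Q Q' : Conf} (h : Relation.ReflTransGen Conf.Step Q Q') (c : ℕ) :
    BehEquiv (Conf.proc id Q c) (Conf.proc id Q' c) := by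
  induction h with
  | refl => exact .refl _
  | tail _ st ih => exact ih.trans (st.expandsMany id c).behEquiv

theorem milner_behEquiv_of_red {s s' : LTerm} (h : Many LTerm.Red s s') (c : ℕ) :
    BehEquiv (milner c s) (milner c s') := by
  induction h with
  | refl => exact .refl _
  | tail _ r ih =>
    refine ih.trans ?_
    rw [milner_eq_proc, milner_eq_proc]
    exact Conf.behEquiv_of_steps (Conf.steps_of_red r) c

theorem milner_behEquiv_of_piRed {s : LTerm} {c : ℕ} {T : PiProc}
    (h : Many PiProc.Red (milner c s) T) : BehEquiv T (milner c s) := by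
  obtain ⟨Z, h, st⟩ := exists_tauMany_of_red h
  obtain ⟨n, h⟩ := h.exists_tauSteps
  rw [milner_eq_proc] at h ⊢
  exact (Expands.of_struct st.symm).behEquiv.trans (Conf.behEquiv_of_tauSteps h)

theorem diverges_of_milner_diverges {s : LTerm} {c : ℕ} (h : Diverges PiProc.Red (milner c s)) :
    Diverges LTerm.Red s := by
  by_contra hs
  have acc : Acc (fun s' s => LTerm.Red s s') s := by
    by_contra hacc
    obtain ⟨f, h₀, hf⟩ := not_acc_iff_exists_descending_chain.1 hacc
    exact hs ⟨f, h₀, hf⟩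
  refine Terminates.not_diverges ?_ h
  rw [milner_eq_proc]
  exact Conf.terminates (by rwa [Conf.toTerm_ofTerm]) id c

theorem milner_rename (c : ℕ) (t : LTerm) (σ : ℕ → ℕ) :
    milner (σ c) (t.rename σ) = (milner c t).rename σ := by
  rw [milner, milner, milnerAux_rename, milnerAux_lrename]
  rfl

/-! ### Compositionality -/

/-- Environments obtained from named binders agree with those of the translation only away from the
chosen fresh names, which suffices. -/
theorem milnerAux_congr {ρ ρ' : ℕ → ℕ} {t : LTerm} (h : ∀ x ∈ t.fv, ρ x = ρ' x) (c : ℕ) :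
    milnerAux ρ t c = milnerAux ρ' t c := by
  induction t generalizing ρ ρ' c with
  | var x => rw [milnerAux, milnerAux, h x rfl]
  | app s t ihs iht =>
    rw [milnerAux, milnerAux, ihs (fun x hx => congrArg (· + 2) (h x (.inl hx))),
      iht (fun x hx => congrArg (· + 2) (h x (.inr hx)))]
  | lam t ih =>
    rw [milnerAux, milnerAux, ih]
    rintro (_ | x) hx
    · rfl
    · exact congrArg (· + 4) (h x hx)

theorem mem_fn_milnerAux {t : LTerm} {x : ℕ} (h : x ∈ t.fv) (ρ : ℕ → ℕ) (c : ℕ) :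
    ρ x ∈ (milnerAux ρ t c).fn := by
  induction t generalizing ρ c x with
  | var y =>
    obtain rfl : x = y := h
    simp [milnerAux, ret, assignVar, fn]
  | app s t ihs iht =>
    rcases h with h | h
    · have := ihs h (fun x => ρ x + 2) 1
      simp [milnerAux, fn, this]
    · have := iht h (fun x => ρ x + 2) 0
      simp [milnerAux, fn, this]
  | lam t ih =>
    have := ih h (bodyNames ρ) 0
    simp only [bodyNames] at this
    simp [milnerAux, ret, assignLam, fn, this]

theorem LTerm.finite_fv (t : LTerm) : t.fv.Finite := by
  induction t with
  | var x => exact Set.finite_singleton x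
  | app s t ihs iht => exact ihs.union iht
  | lam t ih => exact Set.Finite.preimage (Nat.succ_injective.injOn) ih

theorem milner_app {c q r : ℕ} {s t : LTerm} (hqr : q ≠ r) (hqc : c ≠ q) (hrc : c ≠ r)
    (hs : q ∉ s.fv ∧ r ∉ s.fv) (ht : q ∉ t.fv ∧ r ∉ t.fv) :
    milner c (.app s t) = .nu q (.nu r (.par (.par (ap c q r) (milner q s)) (milner r t))) := by
  have key : ∀ u : LTerm, q ∉ u.fv → r ∉ u.fv → ∀ x ∈ u.fv,
      upName (bindName q) (bindName r x) = x + 2 := by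
    intro u hq hr x hx
    have h₁ : x ≠ q := fun e => hq (e ▸ hx)
    have h₂ : x ≠ r := fun e => hr (e ▸ hx)
    simp [bindName, h₁, h₂]
  simp only [milner, milnerAux, nu, PiProc.rename, milnerAux_rename, id]
  rw [milnerAux_congr (key s hs.1 hs.2), milnerAux_congr (key t ht.1 ht.2)]
  simp [ap, PiProc.rename, bindName, hqr, hqc, hrc]

/-- The context of a translated variable. -/
def varCtx (c x y w : ℕ) : PiCtx 0 :=
  .nu y (.output c y (.rep (.input y w (.output x w .nil))))

/-- The context of a translated abstraction. -/
def absCtx (c x y w d : ℕ) : PiCtx 1 :=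
  .nu y (.output c y (.rep (.input y w (.input w x (.input w d (.hole 0))))))

/-- The context of a translated application. -/
def appCtx (c q r y v z : ℕ) : PiCtx 2 :=
  .nu q (.nu r (.par (.par
    (.input q y (.nu v (.output y v (.input r z (.output v z (.output v c .nil))))))
    (.hole 0)) (.hole 1)))

theorem appCtx_isKAry (c q r y v z : ℕ) : (appCtx c q r y v z).IsKAry := by
  intro i
  fin_cases i <;> rfl

theorem milner_compositional (op : LOp) (N : Set ℕ) (c : ℕ) :
    ∃ (C : PiCtx op.arity) (d : Fin op.arity → ℕ), C.IsKAry ∧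
      ∀ S : Fin op.arity → LTerm, (⋃ i, (S i).fv) = N →
        milner c (op.apply S) = C.fill fun i => milner (d i) (S i) := by
  -- Terms have finitely many free variables, so for infinite `N` the requirement is vacuous and `K
  -- = 0` is a dummy value. Otherwise `K` lies above all names in `N`.
  obtain ⟨K, hK⟩ : ∃ K, N.Finite → ∀ n ∈ N, n < K := by
    by_cases h : N.Finite
    · obtain ⟨K, hK⟩ := h.bddAbove
      exact ⟨K + 1, fun _ n hn => Nat.lt_succ_of_le (hK hn)⟩
    · exact ⟨0, fun h' => absurd h' h⟩
  have fresh : ∀ {k : ℕ} (S : Fin k → LTerm), (⋃ i, (S i).fv) = N →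
      ∀ i, ∀ n ∈ (S i).fv, n < K := by
    intro k S hS i n hn
    have fin : N.Finite := hS ▸ Set.finite_iUnion fun i => (S i).finite_fv
    exact hK fin n (hS ▸ Set.mem_iUnion_of_mem i hn)
  cases op with
  | var x =>
    refine ⟨varCtx c x (c + x + 1) (c + x + 2), fun i => i.elim0, fun i => i.elim0, fun S _ => ?_⟩
    have h₁ : c ≠ c + x + 1 := by omega
    have h₂ : x ≠ c + x + 1 := by omega
    have h₃ : x ≠ c + x + 2 := by omega
    simp [LOp.apply, varCtx, PiCtx.fill, milner, milnerAux, ret, assignVar, nu, input,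
      PiProc.rename, bindName, h₁, h₂, h₃]
  | abs x =>
    -- The names `m`, `m + 1`, `m + 2` of the three auxiliary binders exceed `c`, `x` and all of
    -- `N`. The hole is translated at `m + 2`, which the innermost input of the context captures.
    obtain ⟨m, hm⟩ : ∃ m, m = c + x + K + 1 := ⟨_, rfl⟩
    refine ⟨absCtx c x m (m + 1) (m + 2), fun _ => m + 2, fun i => ?_, fun S hS => ?_⟩
    · exact if_pos (Subsingleton.elim (α := Fin 1) _ _)
    have h₁ : c ≠ m := by omega
    have h₂ : x ≠ m := by omega
    have h₃ : x ≠ m + 1 := by omega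
    have h₄ : x ≠ m + 2 := by omega
    have key : ∀ n ∈ (S (0 : Fin 1)).fv, bodyNames id (bindName x n) =
        upName (upName (upName (bindName m))) (upName (upName (bindName (m + 1)))
          (upName (bindName x) (bindName (m + 2) n))) := by
      intro n hn
      have hn := fresh S hS _ n hn
      have h₅ : n ≠ m := by omega
      have h₆ : n ≠ m + 1 := by omega
      have h₇ : n ≠ m + 2 := by omega
      by_cases h : n = x
      · simp [bindName, h, h₄, bodyNames]
      · simp [bindName, h, h₅, h₆, h₇, bodyNames]
    simp only [LOp.apply, absCtx, PiCtx.fill, milner, LTerm.abs, milnerAux, ret, assignLam, nu,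
      input, PiProc.rename, milnerAux_rename, milnerAux_lrename, id]
    rw [milnerAux_congr key]
    simp [bindName, h₁, h₃.symm]
  | app =>
    obtain ⟨m, hm⟩ : ∃ m, m = c + K + 1 := ⟨_, rfl⟩
    refine ⟨appCtx c m (m + 1) (m + 2) (m + 3) (m + 4), ![m, m + 1], appCtx_isKAry _ _ _ _ _ _,
      fun S hS => ?_⟩
    have hf : ∀ i, m ∉ (S i).fv ∧ m + 1 ∉ (S i).fv := fun i =>
      ⟨fun h => by have := fresh S hS i _ h; omega, fun h => by have := fresh S hS i _ h; omega⟩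
    have h₁ : c ≠ m := by omega
    have h₂ : c ≠ m + 1 := by omega
    have h₃ : c ≠ m + 2 := by omega
    have h₄ : c ≠ m + 3 := by omega
    have h₅ : c ≠ m + 4 := by omega
    refine (milner_app (s := S (0 : Fin 2)) (t := S (1 : Fin 2)) (by omega) h₁ h₂
      (hf _) (hf _)).trans ?_
    have hap : ap c m (m + 1) = PiProc.input m (m + 2) (.nu (m + 3) (.out (m + 2) (m + 3)
        (.input (m + 1) (m + 4) (.out (m + 3) (m + 4) (.out (m + 3) c .nil))))) := by
      simp [ap, input, nu, PiProc.rename, bindName, h₃, h₄, h₅]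
    rw [hap]
    rfl

end LambdaPi

/-- Milner's translation, with the renaming policy that maps each name to itself, is a parallel
encoding of the call-by-value lambda-calculus into the pi-calculus. -/
theorem mainTheorem3 :
    LambdaPi.IsParallelEncoding LambdaPi.milner (fun (x : ℕ) (_ : Fin 1) => x) where
  arity_pos := one_pos
  compositionality := LambdaPi.milner_compositional
  name_invariance S c σ σ' h := by
    -- The policy is the identity, so the compatibility condition forces the two substitutions to
    -- agree.
    obtain rfl : σ = σ' := funext fun a => h a 0
    rw [LambdaPi.milner_rename]
    exact ⟨fun _ => rfl, fun _ => .refl _⟩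
  -- No reduction is needed, since the translations of `S` and `S'` are already equivalent; in
  -- `sound`, likewise, `T` is equivalent to the translation of `S` itself.
  complete c S S' h := ⟨_, .refl, LambdaPi.milner_behEquiv_of_red h c⟩
  sound c S T h := ⟨S, .refl, T, .refl, LambdaPi.milner_behEquiv_of_piRed h⟩
  divergence_reflection _ _ h := LambdaPi.diverges_of_milner_diverges h
  parallelisation := by
    refine ⟨LambdaPi.ap 0 1 2, fun c M N n₁ n₂ h h₁ h₂ => ?_⟩
    have free : ∀ n, n ∉ insert c (LambdaPi.milner c (.app M N)).fn →
        c ≠ n ∧ n ∉ M.fv ∧ n ∉ N.fv := by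
      intro n hn
      simp only [Set.mem_insert_iff, not_or] at hn
      exact ⟨Ne.symm hn.1,
        fun h => hn.2 (LambdaPi.mem_fn_milnerAux (t := .app M N) (.inl h) id c),
        fun h => hn.2 (LambdaPi.mem_fn_milnerAux (t := .app M N) (.inr h) id c)⟩
    obtain ⟨a₁, b₁, d₁⟩ := free n₁ h₁
    obtain ⟨a₂, b₂, d₂⟩ := free n₂ h₂
    exact LambdaPi.milner_app h a₁ a₂ ⟨b₁, b₂⟩ ⟨d₁, d₂⟩
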